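/- **Setting.** Let $\alpha$ be a cancellative commutative monoid (written multiplicatively, "power-products") in which any two elements have a least common multiple, in which $1$ is the only invertible element, and which admits a Dickson grading, i.e. a map $d:\alpha\to\mathbb N$ with $d(st)=\max(d(s),d(t))$ such that for every $m$ and every sequence $(s_i)_{i\in\mathbb N}$ in $\alpha$ with $d(s_i)\le m$ for all $i$ there are $i<j$ with $s_i\mid s_j$. Let $\kappa$ be a non-empty well-ordered set and $K$ a field. A *term* is a pair $(t,i)\in\alpha\times\kappa$, also written $t\,e_i$, and $s\,e_i\mid t\,e_j$ means $i=j$ and $s\mid t$. A (vector-)polynomial is a finitely supported map $\alpha\times\kappa\to K$. Fix a linear order $\preceq$ on $\alpha$ with least element $1$ and with $s\preceq t\Rightarrow su\preceq tu$, and a linear order $\preceq_{\sf t}$ on terms such that $s e_i\preceq_{\sf t} t e_j\Rightarrow (us)e_i\preceq_{\sf t}(ut)e_j$, and $s\preceq t\wedge i\le j\Rightarrow s e_i\preceq_{\sf t} t e_j$. For $p\ne0$ let $\mathrm{lt}(p)$ be the greatest term of $p$, $\mathrm{lp}(p)$ its power-product and $\mathrm{lc}(p)$ its coefficient; by convention $\mathrm{lt}(0)$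 is the least term, $\mathrm{lc}(0)=0$ and $1/0=0$. One writes $p\to_F q$ if there are $0\ne f\in F$ and $t\in\alpha$ such that the coefficient $c$ of $t\cdot\mathrm{lt}(f)$ in $p$ is non-zero and $q=p-\frac{c}{\mathrm{lc}(f)}\,t\,f$. A set $G$ of polynomials is a *Gröbner basis* if $\to_G$ is confluent, and $\mathrm{pmdl}(B)$ is the smallest set of polynomials that contains $B\cup\{0\}$ and is closed under addition and under multiplication by monomials $c\,t$ ($c\in K$, $t\in\alpha$). If $\mathrm{lt}(p)$ and $\mathrm{lt}(q)$ have the same component, then $\mathrm{spoly}(p,q)=\frac{1}{\mathrm{lc}(p)}\frac{l}{\mathrm{lp}(p)}\,p-\frac{1}{\mathrm{lc}(q)}\frac{l}{\mathrm{lp}(q)}\,q$ with $l=\mathrm{lcm}(\mathrm{lp}(p),\mathrm{lp}(q))$; otherwise $\mathrm{spoly}(p,q)=0$. **The schema.** Given functions $\mathit{sel}$ and $\mathit{compl}$, $\mathrm{gb\_schema\_aux}(bs,ps)$, for a list $bs$ of polynomials and a list $ps$ of pairs of polynomials, returns $bs$ if $ps=[\,]$ or if for every component $i$ appearing in $bs$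 some non-zero $b\in bs$ has $\mathrm{lt}(b)=1\,e_i$. Otherwise it sets $sps=\mathit{sel}(bs,ps)$ and $hs=\mathit{compl}(bs,ps,sps)$ and calls itself on $bs\mathbin{@}hs$ and the list of pairs consisting of all pairs in $ps$ but not in $sps$, all $(h,b)$ with $h\in hs$, $b\in bs$, and one of $(h_1,h_2)$, $(h_2,h_1)$ for all distinct $h_1,h_2\in hs$. $\mathrm{gb\_schema}(bs)$ starts it on $bs$ with one of the two pairs for any two distinct elements of $bs$. *Requirements.* Whenever $ps\neq[\,]$, $sps=\mathit{sel}(bs,ps)$ is non-empty with all elements in $ps$. Whenever moreover all pairs in $ps$ consist of elements of $bs$, $hs=\mathit{compl}(bs,ps,sps)$ satisfies: (i) $0\notin hs$; (ii) $hs\subseteq\mathrm{pmdl}(bs)$; (iii) $\mathrm{spoly}(p,q)\to^*_{bs\cup hs}0$ for all $(p,q)\in sps$; (iv) $\mathrm{lt}(b)\nmid\mathrm{lt}(h)$ for all $0\ne b\in bs$ and $h\in hs$. *Boundedness.* There is a Dickson grading $d$ such that, in the same situation, for every $m$: if $d(t)\le m$ for all power-products $t$ appearing in $bs$, then $d(t)\le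 m$ for all power-products $t$ appearing in $hs$. (For finitely many indeterminates this holds automatically, with $d=0$.) **Theorem.** 1. Let $\mathit{sel}$, $\mathit{compl}$ satisfy the requirements. If boundedness holds, then $\mathrm{gb\_schema\_aux}(bs,ps)$ terminates for all lists $bs$ and all lists $ps$ of pairs of elements of $bs$; in particular $\mathrm{gb\_schema}(F)$ terminates for every finite list $F$. With or without boundedness, whenever $\mathrm{gb\_schema}(F)$ terminates with result $G$, $G$ is a Gröbner basis and $\mathrm{pmdl}(G)=\mathrm{pmdl}(F)$. 2. Let $\mathrm{trd}(fs,p)$ be total reduction of $p$ modulo the list $fs$: going through the terms of $p$ from the greatest down, each term is reduced by the first non-zero $f\in fs$ with $\mathrm{lt}(f)$ dividing it, or kept if there is none. It terminates for all $fs$ and $p$. Let $\mathrm{gb}$ be the instance of $\mathrm{gb\_schema}$ in which $\mathit{sel}$ selects the first pair and $\mathit{compl}$ returns $[h]$ if $h=\mathrm{trd}(bs,\mathrm{spoly}(p,q))\ne0$ and $[\,]$ otherwise, $(p,q)$ being the selected pair. These parameters satisfy the requirements and boundedness. 3. For every finite list $F$, $\mathrm{gb}(F)$ terminates, and its result $G$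 is a Gröbner basis with $\mathrm{pmdl}(G)=\mathrm{pmdl}(F)$. -/

import Mathlib

/-- A Dickson grading of a commutative monoid: `d (s * t) = max (d s) (d t)`, and every infinite
sequence of bounded degree contains two elements, the earlier of which divides the later. -/
def IsDicksonGrading {α : Type*} [CommMonoid α] (d : α → ℕ) : Prop :=
  (∀ s t : α, d (s * t) = max (d s) (d t)) ∧
  ∀ (m : ℕ) (s : ℕ → α), (∀ i, d (s i) ≤ m) → ∃ i j, i < j ∧ s i ∣ s j

/-- Abstract power-products: cancellative commutative monoids with least common multiples, with
no invertible element except `1`, that admit a Dickson grading. -/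
class GradedDicksonPowerprod (α : Type*) extends CancelCommMonoid α where
  lcm : α → α → α
  dvd_lcm_left : ∀ s t : α, s ∣ lcm s t
  lcm_dvd : ∀ s t u : α, s ∣ u → t ∣ u → lcm s t ∣ u
  lcm_comm : ∀ s t : α, lcm s t = lcm t s
  eq_one_of_mul_eq_one : ∀ s t : α, s * t = 1 → s = 1
  exists_dicksonGrading : ∃ d : α → ℕ, IsDicksonGrading d

/-- Admissible orders on power-products: linear orders with least element `1` that are compatible
with multiplication. -/
structure AdmissibleOrder (α : Type*) [CommMonoid α] where
  le : α → α → Prop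
  le_refl : ∀ s, le s s
  le_trans : ∀ s t u, le s t → le t u → le s u
  le_antisymm : ∀ s t, le s t → le t s → s = t
  le_total : ∀ s t, le s t ∨ le t s
  one_le : ∀ t, le 1 t
  mul_le_mul : ∀ s t u, le s t → le (s * u) (t * u)

/-- Multiplication of a term (a pair of a power-product and a component) by a power-product. -/
def stimes {α κ : Type*} [CommMonoid α] (t : α) (v : α × κ) : α × κ := (t * v.1, v.2)

/-- An admissible order `le` on power-products together with an admissible extension `tle` of it
to terms. -/
structure TermOrder (α κ : Type*) [CommMonoid α] [LinearOrder κ] extends AdmissibleOrder α where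
  tle : α × κ → α × κ → Prop
  tle_refl : ∀ v, tle v v
  tle_trans : ∀ u v w, tle u v → tle v w → tle u w
  tle_antisymm : ∀ v w, tle v w → tle w v → v = w
  tle_total : ∀ v w, tle v w ∨ tle w v
  stimes_mono : ∀ (t : α) (v w : α × κ), tle v w → tle (stimes t v) (stimes t w)
  tle_of_le : ∀ v w : α × κ, le v.1 w.1 → v.2 ≤ w.2 → tle v w

/-- Vector-polynomials: finitely supported maps from terms to coefficients. -/
abbrev VPoly (α κ β : Type*) [Zero β] := (α × κ) →₀ β

/-- Divisibility of terms: equal components and divisible power-products. -/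
def TermDvd {α κ : Type*} [CommMonoid α] (v w : α × κ) : Prop := v.1 ∣ w.1 ∧ v.2 = w.2

open Classical in
/-- The quotient `t / s` of power-products (`1` if `s` does not divide `t`); it is unique by
cancellation. -/
noncomputable def ppDiv {α : Type*} [CancelCommMonoid α] (t s : α) : α :=
  if h : s ∣ t then h.choose else 1

/-- The product `c · t · p` for a coefficient `c`, a power-product `t` and a polynomial `p`. -/
noncomputable def monomMult {α κ β : Type*} [CommMonoid α] [Field β]
    (c : β) (t : α) (p : VPoly α κ β) : VPoly α κ β :=
  c • Finsupp.mapDomain (stimes t) p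

/-- The submodule generated by `B`: the least set that contains `B` and `0` and is closed under
addition and under multiplication by monomials `c · t`. -/
inductive Pmdl {α κ β : Type*} [CommMonoid α] [Field β] (B : Set (VPoly α κ β)) :
    VPoly α κ β → Prop
  | zero : Pmdl B 0
  | base (b : VPoly α κ β) : b ∈ B → Pmdl B b
  | add (p q : VPoly α κ β) : Pmdl B p → Pmdl B q → Pmdl B (p + q)
  | monom (c : β) (t : α) (p : VPoly α κ β) : Pmdl B p → Pmdl B (monomMult c t p)

/-- `Pmdl B` as a set. -/
def pmdl {α κ β : Type*} [CommMonoid α] [Field β] (B : Set (VPoly α κ β)) : Set (VPoly α κ β) :=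
  {p | Pmdl B p}

/-- The set of elements of a list. -/
def listSet {γ : Type*} (l : List γ) : Set γ := {x | x ∈ l}

namespace TermOrder

/-- The least term `1 · e_i`, with `i` the least component. -/
noncomputable def minTerm (α κ : Type*) [CommMonoid α] [LinearOrder κ] [WellFoundedLT κ]
    [Nonempty κ] : α × κ :=
  (1, WellFounded.min (wellFounded_lt (α := κ)) Set.univ Set.univ_nonempty)

section

variable {α κ β : Type*} [GradedDicksonPowerprod α] [LinearOrder κ] [WellFoundedLT κ] [Nonempty κ]
  [Field β] (T : TermOrder α κ)

open Classical in
/-- The leading term: the greatest term with non-zero coefficient if `p ≠ 0`, and by convention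
the least term if `p = 0`. -/
noncomputable def lt (p : VPoly α κ β) : α × κ :=
  if h : ∃ v ∈ p.support, ∀ u ∈ p.support, T.tle u v then h.choose else minTerm α κ

/-- The leading power-product. -/
noncomputable def lp (p : VPoly α κ β) : α := (T.lt p).1

/-- The leading coefficient. -/
noncomputable def lc (p : VPoly α κ β) : β := p (T.lt p)

/-- The tail: `p` with its leading coefficient replaced by `0`. -/
noncomputable def tail (p : VPoly α κ β) : VPoly α κ β := p.erase (T.lt p)

/-- `p` reduces to `q` modulo the single polynomial `f`, using the power-product `t`. -/
def RedSingle (p q f : VPoly α κ β) (t : α) : Prop :=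
  f ≠ 0 ∧ p (stimes t (T.lt f)) ≠ 0 ∧
    q = p - monomMult (p (stimes t (T.lt f)) / T.lc f) t f

/-- One-step reduction modulo the set `F`. -/
def Red (F : Set (VPoly α κ β)) (p q : VPoly α κ β) : Prop :=
  ∃ f ∈ F, ∃ t : α, T.RedSingle p q f t

/-- Reflexive-transitive closure of reduction modulo `F`. -/
def RedStar (F : Set (VPoly α κ β)) : VPoly α κ β → VPoly α κ β → Prop :=
  Relation.ReflTransGen (T.Red F)

/-- `G` is a Gröbner basis iff reduction modulo `G` is confluent. -/
def IsGB (G : Set (VPoly α κ β)) : Prop :=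
  ∀ p q r, T.RedStar G p q → T.RedStar G p r → ∃ s, T.RedStar G q s ∧ T.RedStar G r s

open Classical in
/-- The S-polynomial. -/
noncomputable def spoly (p q : VPoly α κ β) : VPoly α κ β :=
  if (T.lt p).2 = (T.lt q).2 then
    let l := GradedDicksonPowerprod.lcm (T.lp p) (T.lp q)
    monomMult (1 / T.lc p) (ppDiv l (T.lp p)) p - monomMult (1 / T.lc q) (ppDiv l (T.lp q)) q
  else 0

open Classical in
/-- Total reduction modulo the list `fs`, as a tail-recursive partial function. A state `(p, r)`
holds the polynomial `p` still to be reduced and the irreducible part `r` found so far. The leading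
term of `p` is reduced by the first suitable element of `fs`, or moved to `r` if there is none. -/
noncomputable def trdAux (fs : List (VPoly α κ β)) :
    VPoly α κ β × VPoly α κ β →. VPoly α κ β :=
  PFun.fix fun s => Part.some
    (if s.1 = 0 then Sum.inl s.2
    else
      match fs.find? (fun f => decide (f ≠ 0 ∧ TermDvd (T.lt f) (T.lt s.1))) with
      | some f =>
        Sum.inr (s.1 - monomMult (T.lc s.1 / T.lc f) (ppDiv (T.lp s.1) (T.lp f)) f, s.2)
      | none => Sum.inr (T.tail s.1, s.2 + Finsupp.single (T.lt s.1) (T.lc s.1)))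

open Classical in
/-- The value of total reduction (`0` on arguments where it did not terminate). -/
noncomputable def trd (fs : List (VPoly α κ β)) (p : VPoly α κ β) : VPoly α κ β :=
  (T.trdAux fs (p, 0)).getOrElse 0

/-- For every component that appears in `bs` there is a non-zero element of `bs` whose leading
term is the unit power-product in that component. -/
def GenWholeModule (bs : List (VPoly α κ β)) : Prop :=
  ∀ b ∈ bs, ∀ v ∈ b.support, ∃ f ∈ bs, f ≠ 0 ∧ (T.lt f).2 = v.2 ∧ T.lp f = 1

end

end TermOrder

/-- All pairs `(x, y)` where `x` stands before `y` in the list. -/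
def listPairs {γ : Type*} : List γ → List (γ × γ)
  | [] => []
  | x :: xs => xs.map (fun y => (x, y)) ++ listPairs xs

open Classical in
/-- All pairs from `ps`, all pairs `(h, b)` with `h ∈ hs` and `b ∈ bs`, and for any two distinct
elements of `hs` one of the two pairs formed by them. -/
noncomputable def addPairs {γ : Type*} (bs : List γ) (ps : List (γ × γ)) (hs : List γ) :
    List (γ × γ) :=
  ps ++ (hs.product bs ++ listPairs hs.dedup)

open Classical in
/-- Removes all occurrences of all elements of `ys` from `xs`. -/
noncomputable def diffList {γ : Type*} (xs ys : List γ) : List γ :=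
  xs.filter (fun x => decide (x ∉ ys))

/-- Pair selection: `sel bs ps`. -/
abbrev SelFun (α κ β : Type*) [Zero β] :=
  List (VPoly α κ β) → List (VPoly α κ β × VPoly α κ β) → List (VPoly α κ β × VPoly α κ β)

/-- Completion: `compl bs ps sps`. -/
abbrev ComplFun (α κ β : Type*) [Zero β] :=
  List (VPoly α κ β) → List (VPoly α κ β × VPoly α κ β) → List (VPoly α κ β × VPoly α κ β) →
    List (VPoly α κ β)

/-- All entries of the pairs in `ps` belong to `bs`. -/
def PairsFrom {γ : Type*} (bs : List γ) (ps : List (γ × γ)) : Prop :=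
  ∀ x ∈ ps, x.1 ∈ bs ∧ x.2 ∈ bs

section

variable {α κ β : Type*} [GradedDicksonPowerprod α] [LinearOrder κ] [WellFoundedLT κ] [Nonempty κ]
  [Field β]

/-- The requirements on the parameters `sel` and `compl`. Those on `compl` concern the calls of the
schema: `ps` consists of pairs of elements of `bs`, and `sps` is the selection made by `sel`. -/
structure SchemaRequirements (T : TermOrder α κ) (sel : SelFun α κ β) (compl : ComplFun α κ β) :
    Prop where
  sel_ne_nil : ∀ bs ps, ps ≠ [] → sel bs ps ≠ []
  sel_subset : ∀ bs ps, ps ≠ [] → sel bs ps ⊆ ps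
  zero_notMem : ∀ bs ps, ps ≠ [] → PairsFrom bs ps → 0 ∉ compl bs ps (sel bs ps)
  mem_pmdl : ∀ bs ps, ps ≠ [] → PairsFrom bs ps →
    ∀ h ∈ compl bs ps (sel bs ps), h ∈ pmdl (listSet bs)
  spoly_red : ∀ bs ps, ps ≠ [] → PairsFrom bs ps →
    ∀ x ∈ sel bs ps,
      T.RedStar (listSet bs ∪ listSet (compl bs ps (sel bs ps))) (T.spoly x.1 x.2) 0
  not_dvd : ∀ bs ps, ps ≠ [] → PairsFrom bs ps →
    ∀ b ∈ bs, b ≠ 0 → ∀ h ∈ compl bs ps (sel bs ps), ¬ TermDvd (T.lt b) (T.lt h)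

/-- For some Dickson grading, completion never exceeds a bound on the degrees of the
power-products that appear in the current basis. -/
def GradingBounded (sel : SelFun α κ β) (compl : ComplFun α κ β) : Prop :=
  ∃ d : α → ℕ, IsDicksonGrading d ∧
    ∀ bs ps, ps ≠ [] → PairsFrom bs ps → ∀ m : ℕ,
      (∀ b ∈ bs, ∀ v ∈ b.support, d v.1 ≤ m) →
      ∀ h ∈ compl bs ps (sel bs ps), ∀ v ∈ h.support, d v.1 ≤ m

open Classical in
/-- The critical-pair/completion schema, as a tail-recursive partial function of the current basis
and the list of pairs still to be considered. It is defined at a state iff the recursion that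
starts there terminates. -/
noncomputable def gbSchemaAux (T : TermOrder α κ) (sel : SelFun α κ β) (compl : ComplFun α κ β) :
    List (VPoly α κ β) × List (VPoly α κ β × VPoly α κ β) →. List (VPoly α κ β) :=
  PFun.fix fun s => Part.some
    (if s.2 = [] ∨ T.GenWholeModule s.1 then Sum.inl s.1
    else
      let sps := sel s.1 s.2
      let hs := compl s.1 s.2 sps
      Sum.inr (s.1 ++ hs, addPairs s.1 (diffList s.2 sps) hs))

/-- The schema, started with the input list and the pairs of its elements. -/
noncomputable def gbSchema (T : TermOrder α κ) (sel : SelFun α κ β) (compl : ComplFun α κ β)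
    (bs : List (VPoly α κ β)) : Part (List (VPoly α κ β)) :=
  gbSchemaAux T sel compl (bs, addPairs [] [] bs)

/-- Selection in Buchberger's algorithm: the first pair. -/
def gbSel : SelFun α κ β := fun _ ps => ps.take 1

open Classical in
/-- Completion in Buchberger's algorithm: the normal form, if non-zero, of the S-polynomial of the
selected pair. -/
noncomputable def gbCompl (T : TermOrder α κ) : ComplFun α κ β := fun bs _ sps =>
  match sps with
  | [] => []
  | x :: _ =>
    let h := T.trd bs (T.spoly x.1 x.2)
    if h = 0 then [] else [h]

/-- Buchberger's algorithm. -/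
noncomputable def gb (T : TermOrder α κ) (bs : List (VPoly α κ β)) : Part (List (VPoly α κ β)) :=
  gbSchema T gbSel (gbCompl T) bs

end

/-! The main tool is `leadSpan T F P`, the span of the multiples `t · f` whose leading terms satisfy
`P`. A reduction step subtracts a multiple whose leading term occurs in the polynomial being
reduced. Hence `p →* 0` writes `p` through multiples whose leading terms obey the bounds on the
terms of `p`.

The term order need not be well-founded, for instance with infinitely many indeterminates. By
Dickson's property it is well-founded in bounded degree (`wellFounded_boundedLt`), and because
degrees of products are maxima, neither S-polynomials nor reduction leave that range. So the
inductions on terms are carried out in bounded degree.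

Buchberger's criterion: let `v` bound the leading terms in a representation of `p ≠ 0`. Two
normalised multiples with leading term `v` differ by a multiple of an S-polynomial, hence by
multiples with smaller leading terms. So either `v` is the leading term of `p`, and some leading
term of `F` divides it, or `v` can be lowered (`exists_termDvd_of_mem_leadSpan`). Confluence
follows: total reduction of two reducts of one polynomial gives normal forms whose difference lies
in the submodule, and a non-zero difference would have a reducible leading term.

A step of the schema either adds a leading term that no earlier one divides, which happens only
finitely often in bounded degree and finitely many components, or it shortens the list of pairs.
Each pair of distinct elements stays pending until its S-polynomial reduces to zero, so the
criterion applies when no pair is left; the early exit is treated separately. -/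

/-! ### Termination and invariants of iterated partial functions -/

theorem PFun.dom_fix_of_wellFounded {σ τ : Type*} {f : σ →. τ ⊕ σ} {step : σ → τ ⊕ σ}
    (hf : ∀ s, f s = Part.some (step s)) {I : σ → Prop} {r : σ → σ → Prop} (hr : WellFounded r)
    (h : ∀ s s', I s → step s = Sum.inr s' → I s' ∧ r s' s) {s : σ} (hs : I s) :
    (f.fix s).Dom := by
  induction s using hr.induction with
  | _ s ih =>
    rcases hstep : step s with b | s'
    · exact Part.dom_iff_mem.2 ⟨b, PFun.fix_stop (by simp [hf, hstep])⟩
    · rw [PFun.fix_fwd_eq (a' := s') (by simp [hf, hstep])]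
      exact ih s' (h s s' hs hstep).2 (h s s' hs hstep).1

theorem PFun.exists_final_of_mem_fix {σ τ : Type*} {f : σ →. τ ⊕ σ} {step : σ → τ ⊕ σ}
    (hf : ∀ s, f s = Part.some (step s)) {I : σ → Prop}
    (h : ∀ s s', I s → step s = Sum.inr s' → I s') {s : σ} (hs : I s) {b : τ}
    (hb : b ∈ f.fix s) : ∃ s', I s' ∧ step s' = Sum.inl b := by
  revert hs
  refine PFun.fixInduction' (C := fun s => I s → ∃ s', I s' ∧ step s' = Sum.inl b) hb ?_ ?_
  · intro s hs hI
    exact ⟨s, hI, (Part.mem_some_iff.1 (hf s ▸ hs)).symm⟩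
  · intro s s' _ hs ih hI
    exact ih (h s s' hI (Part.mem_some_iff.1 (hf s ▸ hs)).symm)

/-! ### Dickson gradings -/

namespace IsDicksonGrading

variable {α κ : Type*} [CommMonoid α] {d : α → ℕ}

theorem le_of_dvd (hd : IsDicksonGrading d) {s t : α} (h : s ∣ t) : d s ≤ d t := by
  obtain ⟨u, rfl⟩ := h
  rw [hd.1]
  exact le_max_left _ _

theorem mul_le (hd : IsDicksonGrading d) {s t : α} {m : ℕ} (hs : d s ≤ m) (ht : d t ≤ m) :
    d (s * t) ≤ m := by
  rw [hd.1]
  exact max_le hs ht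

/-- Divisibility is a well-quasi-order on the elements of degree at most `m`, and a product of two
well-quasi-orders is again one. -/
theorem exists_dvd_and_rel (hd : IsDicksonGrading d) {r : κ → κ → Prop} (hr : WellQuasiOrdered r)
    {m : ℕ} (v : ℕ → α × κ) (hv : ∀ i, d (v i).1 ≤ m) :
    ∃ i j, i < j ∧ (v i).1 ∣ (v j).1 ∧ r (v i).2 (v j).2 := by
  have hwqo : WellQuasiOrdered (fun s t : {s : α // d s ≤ m} => s.1 ∣ t.1) :=
    fun f => hd.2 m (fun i => (f i).1) fun i => (f i).2
  have : IsPreorder {s : α // d s ≤ m} (fun s t => s.1 ∣ t.1) :=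
    { refl := fun s => dvd_refl s.1
      trans := fun s t u => dvd_trans (a := s.1) }
  exact hwqo.prod hr fun i => (⟨(v i).1, hv i⟩, (v i).2)

end IsDicksonGrading

/-! ### Arithmetic of power-products, terms and monomial multiples -/

namespace GradedDicksonPowerprod

variable {α : Type*} [GradedDicksonPowerprod α]

theorem lcm_dvd_mul (s t : α) : GradedDicksonPowerprod.lcm s t ∣ s * t :=
  GradedDicksonPowerprod.lcm_dvd s t _ (dvd_mul_right s t) (dvd_mul_left t s)

theorem dvd_lcm_right (s t : α) : t ∣ GradedDicksonPowerprod.lcm s t :=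
  GradedDicksonPowerprod.lcm_comm t s ▸ GradedDicksonPowerprod.dvd_lcm_left t s

end GradedDicksonPowerprod

section Stimes

variable {α κ : Type*} [CancelCommMonoid α]

theorem stimes_injective (t : α) : Function.Injective (stimes t : α × κ → α × κ) := by
  rintro ⟨a, i⟩ ⟨b, j⟩ h
  simp only [stimes, Prod.mk.injEq, mul_right_inj] at h
  exact Prod.ext h.1 h.2

theorem stimes_one (v : α × κ) : stimes 1 v = v := by
  simp [stimes]

theorem stimes_stimes (s t : α) (v : α × κ) : stimes s (stimes t v) = stimes (s * t) v := by
  simp [stimes, mul_assoc]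

theorem ppDiv_mul {s t : α} (h : s ∣ t) : ppDiv t s * s = t := by
  rw [ppDiv, dif_pos h, mul_comm]
  exact h.choose_spec.symm

theorem ppDiv_dvd {s t : α} (h : s ∣ t) : ppDiv t s ∣ t :=
  ⟨s, (ppDiv_mul h).symm⟩

theorem termDvd_iff {v w : α × κ} : TermDvd v w ↔ ∃ t, stimes t v = w := by
  constructor
  · rintro ⟨⟨t, ht⟩, hc⟩
    exact ⟨t, Prod.ext (by rw [ht, stimes, mul_comm]) hc⟩
  · rintro ⟨t, rfl⟩
    exact ⟨dvd_mul_left _ _, rfl⟩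

end Stimes

section MonomMult

variable {α κ β : Type*} [CancelCommMonoid α] [Field β]

theorem monomMult_apply_stimes (c : β) (t : α) (p : VPoly α κ β) (v : α × κ) :
    monomMult c t p (stimes t v) = c * p v := by
  rw [monomMult, Finsupp.smul_apply, Finsupp.mapDomain_apply (stimes_injective t), smul_eq_mul]

theorem exists_of_monomMult_apply_ne_zero {c : β} {t : α} {p : VPoly α κ β} {v : α × κ}
    (h : monomMult c t p v ≠ 0) : ∃ w ∈ p.support, stimes t w = v := by
  classical
  have h' : v ∈ (Finsupp.mapDomain (stimes t) p).support := by
    rw [Finsupp.mem_support_iff]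
    intro h0
    exact h (by rw [monomMult, Finsupp.smul_apply, h0, smul_zero])
  exact Finset.mem_image.1 (Finsupp.mapDomain_support h')

theorem monomMult_add (c : β) (t : α) (p q : VPoly α κ β) :
    monomMult c t (p + q) = monomMult c t p + monomMult c t q := by
  rw [monomMult, Finsupp.mapDomain_add, smul_add, monomMult, monomMult]

theorem monomMult_zero (c : β) (t : α) : monomMult c t (0 : VPoly α κ β) = 0 := by
  simp [monomMult]

theorem monomMult_smul (c e : β) (t : α) (p : VPoly α κ β) :
    monomMult c t (e • p) = monomMult (c * e) t p := by
  rw [monomMult, Finsupp.mapDomain_smul, smul_smul, monomMult]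

theorem smul_monomMult (c e : β) (t : α) (p : VPoly α κ β) :
    e • monomMult c t p = monomMult (e * c) t p := by
  rw [monomMult, smul_smul, monomMult]

theorem monomMult_monomMult (c e : β) (s t : α) (p : VPoly α κ β) :
    monomMult c s (monomMult e t p) = monomMult (c * e) (s * t) p := by
  rw [monomMult, monomMult, Finsupp.mapDomain_smul, ← Finsupp.mapDomain_comp, smul_smul, monomMult]
  congr 2
  funext v
  exact stimes_stimes s t v

theorem monomMult_one_right (c : β) (p : VPoly α κ β) : monomMult c 1 p = c • p := by
  rw [monomMult]
  congr 1
  convert Finsupp.mapDomain_id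
  funext v
  exact stimes_one v

theorem monomMult_sub (c : β) (t : α) (p q : VPoly α κ β) :
    monomMult c t (p - q) = monomMult c t p - monomMult c t q := by
  rw [eq_sub_iff_add_eq, ← monomMult_add, sub_add_cancel]

end MonomMult

theorem exists_degree_bound {α κ β : Type*} [Zero β] (d : α → ℕ) (l : List (VPoly α κ β)) :
    ∃ m, ∀ f ∈ l, ∀ v ∈ f.support, d v.1 ≤ m := by
  induction l with
  | nil => exact ⟨0, by simp⟩
  | cons f l ih =>
    obtain ⟨m, hm⟩ := ih
    refine ⟨max m (f.support.sup fun v => d v.1), fun g hg v hv => ?_⟩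
    rcases List.mem_cons.1 hg with rfl | hg
    · exact (Finset.le_sup (f := fun v : α × κ => d v.1) hv).trans (le_max_right _ _)
    · exact (hm g hg v hv).trans (le_max_left _ _)

/-! ### Term orders and spans with bounded leading terms -/

namespace TermOrder

section Order

variable {α κ : Type*} [CancelCommMonoid α] [LinearOrder κ] (T : TermOrder α κ)

/-- The strict order on terms. -/
def tlt (v w : α × κ) : Prop := T.tle v w ∧ v ≠ w

variable {T}

theorem tlt.trans_tle {u v w : α × κ} (h : T.tlt u v) (h' : T.tle v w) : T.tlt u w :=
  ⟨T.tle_trans _ _ _ h.1 h', by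
    rintro rfl
    exact h.2 (T.tle_antisymm _ _ h.1 h')⟩

theorem tle_trans_tlt {u v w : α × κ} (h : T.tle u v) (h' : T.tlt v w) : T.tlt u w :=
  ⟨T.tle_trans _ _ _ h h'.1, by
    rintro rfl
    exact h'.2 (T.tle_antisymm _ _ h'.1 h)⟩

theorem stimes_tlt {v w : α × κ} (h : T.tlt v w) (t : α) : T.tlt (stimes t v) (stimes t w) :=
  ⟨T.stimes_mono t v w h.1, fun h' => h.2 (stimes_injective t h')⟩

theorem tle_of_dvd {v w : α × κ} (h : v.1 ∣ w.1) (hc : v.2 ≤ w.2) : T.tle v w := by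
  obtain ⟨u, hu⟩ := h
  refine T.tle_of_le v w ?_ hc
  have := T.mul_le_mul 1 u v.1 (T.one_le u)
  rwa [one_mul, mul_comm, ← hu] at this

variable (T) in
/-- The strict order on terms, restricted on the left to terms of degree at most `m`. -/
def boundedLt (d : α → ℕ) (m : ℕ) (v w : α × κ) : Prop := d v.1 ≤ m ∧ T.tlt v w

/-- In a descending chain of bounded degree some earlier term divides a later one, with component at
most that of the later one. Admissibility then puts it below the later term, a contradiction. -/
theorem wellFounded_boundedLt [WellFoundedLT κ] {d : α → ℕ} (hd : IsDicksonGrading d) (m : ℕ) :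
    WellFounded (T.boundedLt d m) := by
  rw [wellFounded_iff_isEmpty_descending_chain]
  refine ⟨fun ⟨f, hf⟩ => ?_⟩
  -- The relation bounds the degree of its smaller argument only, so the first term of the chain is
  -- dropped.
  obtain ⟨i, j, hij, hdvd, hle⟩ := hd.exists_dvd_and_rel (wellQuasiOrdered_le (α := κ))
    (fun i => f (i + 1)) fun i => (hf i).1
  have key : ∀ k, T.tlt (f (i + 1 + k + 1)) (f (i + 1)) := by
    intro k
    induction k with
    | zero => exact (hf _).2
    | succ k ih => exact (hf _).2.trans_tle ih.1
  obtain ⟨k, rfl⟩ := Nat.exists_eq_add_of_lt hij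
  have h := key k
  rw [show i + 1 + k + 1 = i + k + 1 + 1 by omega] at h
  exact (h.trans_tle (tle_of_dvd hdvd hle)).2 rfl

theorem exists_greatest {s : Finset (α × κ)} (hs : s.Nonempty) :
    ∃ v ∈ s, ∀ u ∈ s, T.tle u v := by
  induction hs using Finset.Nonempty.cons_induction with
  | singleton a => exact ⟨a, by simp, by simpa using T.tle_refl a⟩
  | cons a s ha hs ih =>
    obtain ⟨v, hv, hmax⟩ := ih
    rcases T.tle_total a v with h | h
    · refine ⟨v, by simp [hv], fun u hu => ?_⟩
      rcases Finset.mem_cons.1 hu with rfl | hu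
      exacts [h, hmax u hu]
    · refine ⟨a, by simp, fun u hu => ?_⟩
      rcases Finset.mem_cons.1 hu with rfl | hu
      exacts [T.tle_refl _, T.tle_trans _ _ _ (hmax u hu) h]

end Order

section Lead

variable {α κ β : Type*} [GradedDicksonPowerprod α] [LinearOrder κ] [WellFoundedLT κ] [Nonempty κ]
  [Field β] {T : TermOrder α κ}

theorem lt_spec {p : VPoly α κ β} (hp : p ≠ 0) :
    T.lt p ∈ p.support ∧ ∀ u ∈ p.support, T.tle u (T.lt p) := by
  have h : ∃ v ∈ p.support, ∀ u ∈ p.support, T.tle u v :=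
    exists_greatest (Finsupp.support_nonempty_iff.2 hp)
  rw [lt, dif_pos h]
  exact h.choose_spec

theorem tle_lt {p : VPoly α κ β} {u : α × κ} (hu : u ∈ p.support) : T.tle u (T.lt p) :=
  (lt_spec (by rintro rfl; simp at hu)).2 u hu

theorem lt_eq {p : VPoly α κ β} {v : α × κ} (hv : v ∈ p.support)
    (hmax : ∀ u ∈ p.support, T.tle u v) : T.lt p = v :=
  T.tle_antisymm _ _ (hmax _ (lt_spec (by rintro rfl; simp at hv)).1) (tle_lt hv)

theorem lc_ne_zero {p : VPoly α κ β} (hp : p ≠ 0) : T.lc p ≠ 0 :=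
  Finsupp.mem_support_iff.1 (lt_spec hp).1

/-- The span of the multiples `t · f` of the non-zero elements `f` of `F` whose leading terms
satisfy `P`. -/
noncomputable def leadSpan (T : TermOrder α κ) (F : Set (VPoly α κ β)) (P : α × κ → Prop) :
    Submodule β (VPoly α κ β) :=
  Submodule.span β {q | ∃ f ∈ F, f ≠ 0 ∧ ∃ t, P (stimes t (T.lt f)) ∧ q = monomMult 1 t f}

variable {F : Set (VPoly α κ β)} {P Q : α × κ → Prop}

theorem monomMult_mem_leadSpan {f : VPoly α κ β} (hf : f ∈ F) (h0 : f ≠ 0) {t : α}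
    (ht : P (stimes t (T.lt f))) (c : β) : monomMult c t f ∈ T.leadSpan F P := by
  have h := (T.leadSpan F P).smul_mem c (Submodule.subset_span ⟨f, hf, h0, t, ht, rfl⟩)
  rwa [smul_monomMult, mul_one] at h

theorem leadSpan_mono (h : ∀ v, P v → Q v) : T.leadSpan F P ≤ T.leadSpan F Q :=
  Submodule.span_mono fun _ ⟨f, hf, h0, t, ht, hq⟩ => ⟨f, hf, h0, t, h _ ht, hq⟩

theorem monomMult_mem_leadSpan_of_mem {u : α} (h : ∀ v, P v → Q (stimes u v)) (c : β)
    {p : VPoly α κ β} (hp : p ∈ T.leadSpan F P) : monomMult c u p ∈ T.leadSpan F Q := by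
  induction hp using Submodule.span_induction with
  | mem q hq =>
    obtain ⟨f, hf, h0, t, ht, rfl⟩ := hq
    rw [monomMult_monomMult]
    exact monomMult_mem_leadSpan hf h0 (stimes_stimes u t (T.lt f) ▸ h _ ht) _
  | zero =>
    rw [monomMult_zero]
    exact zero_mem _
  | add p q _ _ hp hq =>
    rw [monomMult_add]
    exact add_mem hp hq
  | smul e p _ hp =>
    rw [monomMult_smul, mul_comm, ← smul_monomMult]
    exact Submodule.smul_mem _ _ hp

theorem mem_pmdl_iff {p : VPoly α κ β} : p ∈ pmdl F ↔ p ∈ T.leadSpan F fun _ => True := by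
  constructor
  · intro h
    induction h with
    | zero => exact zero_mem _
    | base b hb =>
      by_cases h0 : b = 0
      · exact h0 ▸ zero_mem _
      · simpa [monomMult_one_right] using
          monomMult_mem_leadSpan (T := T) (P := fun _ => True) hb h0 (t := 1) trivial 1
    | add p q _ _ hp hq => exact add_mem hp hq
    | monom c t p _ hp => exact monomMult_mem_leadSpan_of_mem (fun _ _ => trivial) c hp
  · intro h
    induction h using Submodule.span_induction with
    | mem q hq =>
      obtain ⟨f, hf, -, t, -, rfl⟩ := hq
      exact Pmdl.monom _ _ _ (Pmdl.base _ hf)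
    | zero => exact Pmdl.zero
    | add p q _ _ hp hq => exact Pmdl.add _ _ hp hq
    | smul e p _ hp => exact monomMult_one_right e p ▸ Pmdl.monom e 1 p hp

/-- Multiples of elements of `F` whose leading terms satisfy `P` have all their terms in `P`. -/
def LeadClosed (T : TermOrder α κ) (F : Set (VPoly α κ β)) (P : α × κ → Prop) : Prop :=
  ∀ f ∈ F, ∀ t, P (stimes t (T.lt f)) → ∀ v ∈ f.support, P (stimes t v)

theorem leadSpan_support (hP : T.LeadClosed F P) {p : VPoly α κ β} (hp : p ∈ T.leadSpan F P) :
    ∀ v ∈ p.support, P v := by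
  classical
  induction hp using Submodule.span_induction with
  | mem q hq =>
    obtain ⟨f, hf, -, t, ht, rfl⟩ := hq
    intro v hv
    obtain ⟨w, hw, rfl⟩ := exists_of_monomMult_apply_ne_zero (Finsupp.mem_support_iff.1 hv)
    exact hP f hf t ht w hw
  | zero => simp
  | add p q _ _ hp hq =>
    intro v hv
    exact (Finset.mem_union.1 (Finsupp.support_add hv)).elim (hp v) (hq v)
  | smul e p _ hp => exact fun v hv => hp v (Finsupp.support_smul hv)

theorem Red.sub_mem_leadSpan {p q : VPoly α κ β} (h : T.Red F p q) (hp : ∀ v ∈ p.support, P v) :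
    p - q ∈ T.leadSpan F P := by
  obtain ⟨f, hf, t, h0, hc, rfl⟩ := h
  rw [sub_sub_cancel]
  exact monomMult_mem_leadSpan hf h0 (hp _ (Finsupp.mem_support_iff.2 hc)) _

/-- Each step subtracts a multiple whose leading term is a term of the current polynomial and hence
satisfies `P`; closedness passes `P` on to the terms of the result. For `q = 0` this turns a
reduction into a representation with controlled leading terms. -/
theorem RedStar.sub_mem_leadSpan (hP : T.LeadClosed F P) {p q : VPoly α κ β}
    (h : T.RedStar F p q) (hp : ∀ v ∈ p.support, P v) : p - q ∈ T.leadSpan F P := by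
  classical
  induction h with
  | refl => simp
  | tail _ hr ih =>
    rename_i b c _
    have hb : ∀ v ∈ b.support, P v := by
      intro v hv
      rw [← sub_sub_cancel p b] at hv
      exact (Finset.mem_union.1 (Finsupp.support_sub hv)).elim (hp v) (leadSpan_support hP ih v)
    have := add_mem ih (hr.sub_mem_leadSpan hb)
    rwa [sub_add_sub_cancel] at this

theorem RedStar.mono {F G : Set (VPoly α κ β)} (hFG : F ⊆ G) {p q : VPoly α κ β}
    (h : T.RedStar F p q) : T.RedStar G p q :=
  Relation.ReflTransGen.mono (fun _ _ ⟨f, hf, h⟩ => ⟨f, hFG hf, h⟩) _ _ h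

theorem leadClosed_true : T.LeadClosed F fun _ => True := fun _ _ _ _ _ _ => trivial

/-- The cofactor `t` divides the power-product of `t · lt f`, so its degree is at most `m`, and
products of elements of degree at most `m` stay within `m`. -/
theorem leadClosed_degree {d : α → ℕ} (hd : IsDicksonGrading d) {m : ℕ}
    (hF : ∀ f ∈ F, ∀ v ∈ f.support, d v.1 ≤ m) : T.LeadClosed F fun v => d v.1 ≤ m :=
  fun f hf _ ht v hv => hd.mul_le ((hd.le_of_dvd (dvd_mul_right _ _)).trans ht) (hF f hf v hv)

theorem leadClosed_tle (v₀ : α × κ) : T.LeadClosed F fun v => T.tle v v₀ :=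
  fun _ _ t ht _ hv => T.tle_trans _ _ _ (T.stimes_mono t _ _ (tle_lt hv)) ht

theorem leadClosed_tlt (v₀ : α × κ) : T.LeadClosed F fun v => T.tlt v v₀ :=
  fun _ _ t ht _ hv => tle_trans_tlt (T.stimes_mono t _ _ (tle_lt hv)) ht

theorem LeadClosed.and (hP : T.LeadClosed F P) (hQ : T.LeadClosed F Q) :
    T.LeadClosed F fun v => P v ∧ Q v :=
  fun f hf t ht v hv => ⟨hP f hf t ht.1 v hv, hQ f hf t ht.2 v hv⟩

end Lead

end TermOrder

/-! ### Total reduction -/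

namespace TermOrder

variable {α κ β : Type*} [GradedDicksonPowerprod α] [LinearOrder κ] [WellFoundedLT κ] [Nonempty κ]
  [Field β] {T : TermOrder α κ}

theorem RedStar.support {F : Set (VPoly α κ β)} {P : α × κ → Prop} (hP : T.LeadClosed F P)
    {p q : VPoly α κ β} (h : T.RedStar F p q) (hp : ∀ v ∈ p.support, P v) :
    ∀ v ∈ q.support, P v := by
  classical
  intro v hv
  rw [← sub_sub_cancel p q] at hv
  exact (Finset.mem_union.1 (Finsupp.support_sub hv)).elim (hp v)
    (leadSpan_support hP (h.sub_mem_leadSpan hP hp) v)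

theorem tlt_of_mem_support_reduce {p f : VPoly α κ β} (hf : f ≠ 0) {t : α}
    (ht : stimes t (T.lt f) = T.lt p) {v : α × κ}
    (hv : v ∈ (p - monomMult (T.lc p / T.lc f) t f).support) : T.tlt v (T.lt p) := by
  classical
  constructor
  · rcases Finset.mem_union.1 (Finsupp.support_sub hv) with h | h
    · exact tle_lt h
    · obtain ⟨w, hw, rfl⟩ := exists_of_monomMult_apply_ne_zero (Finsupp.mem_support_iff.1 h)
      exact ht ▸ T.stimes_mono t _ _ (tle_lt hw)
  · rintro rfl
    rw [Finsupp.mem_support_iff, Finsupp.sub_apply, ← ht, monomMult_apply_stimes, ht] at hv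
    exact hv (by
      change T.lc p - T.lc p / T.lc f * T.lc f = 0
      rw [div_mul_cancel₀ _ (lc_ne_zero hf), sub_self])

theorem tlt_of_mem_support_tail {p : VPoly α κ β} {v : α × κ} (hv : v ∈ (T.tail p).support) :
    T.tlt v (T.lt p) := by
  classical
  rw [tail, Finsupp.support_erase, Finset.mem_erase] at hv
  exact ⟨tle_lt hv.2, hv.1⟩

open Classical in
/-- One step of total reduction: the result, or the next state. -/
noncomputable def trdStep (T : TermOrder α κ) (fs : List (VPoly α κ β))
    (s : VPoly α κ β × VPoly α κ β) : VPoly α κ β ⊕ VPoly α κ β × VPoly α κ β :=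
  if s.1 = 0 then Sum.inl s.2
  else
    match fs.find? (fun f => decide (f ≠ 0 ∧ TermDvd (T.lt f) (T.lt s.1))) with
    | some f =>
      Sum.inr (s.1 - monomMult (T.lc s.1 / T.lc f) (ppDiv (T.lp s.1) (T.lp f)) f, s.2)
    | none => Sum.inr (T.tail s.1, s.2 + Finsupp.single (T.lt s.1) (T.lc s.1))

theorem trdStep_eq_inl {fs : List (VPoly α κ β)} {s : VPoly α κ β × VPoly α κ β}
    {b : VPoly α κ β} (h : T.trdStep fs s = Sum.inl b) : s = (0, b) := by
  unfold trdStep at h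
  split_ifs at h with h0
  · exact Prod.ext h0 (Sum.inl_injective h)
  · split at h <;> cases h

theorem trdStep_eq_inr {fs : List (VPoly α κ β)} {s s' : VPoly α κ β × VPoly α κ β}
    (h : T.trdStep fs s = Sum.inr s') :
    s.1 ≠ 0 ∧
      ((∃ f ∈ fs, f ≠ 0 ∧ ∃ t, stimes t (T.lt f) = T.lt s.1 ∧
          s' = (s.1 - monomMult (T.lc s.1 / T.lc f) t f, s.2)) ∨
        ((∀ f ∈ fs, f ≠ 0 → ¬ TermDvd (T.lt f) (T.lt s.1)) ∧
          s' = (T.tail s.1, s.2 + Finsupp.single (T.lt s.1) (T.lc s.1)))) := by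
  unfold trdStep at h
  split_ifs at h with h0
  refine ⟨h0, ?_⟩
  split at h
  · rename_i f hf
    have hdvd := List.find?_some hf
    simp only [decide_eq_true_eq] at hdvd
    exact Or.inl ⟨f, List.mem_of_find?_eq_some hf, hdvd.1, _,
      Prod.ext (ppDiv_mul hdvd.2.1) hdvd.2.2, (Sum.inr_injective h).symm⟩
  · rename_i hf
    refine Or.inr ⟨fun f hf' h0' hdvd => ?_, (Sum.inr_injective h).symm⟩
    have := List.find?_eq_none.1 hf f hf'
    simp only [decide_eq_true_eq] at this
    exact this ⟨h0', hdvd⟩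

/-- As `r` does not contain the leading term of `p`, reducing `p + r` there uses the same
coefficient as reducing `p` alone. -/
theorem red_lead {fs : List (VPoly α κ β)} {f p : VPoly α κ β} (hf : f ∈ fs) (h0 : f ≠ 0)
    (hp : p ≠ 0) {t : α} (ht : stimes t (T.lt f) = T.lt p) {r : VPoly α κ β}
    (hr : r (T.lt p) = 0) :
    T.Red (listSet fs) (p + r) (p - monomMult (T.lc p / T.lc f) t f + r) := by
  have hc : (p + r) (stimes t (T.lt f)) = T.lc p := by
    rw [ht, Finsupp.add_apply, hr, add_zero, lc]
  refine ⟨f, hf, t, h0, hc ▸ lc_ne_zero hp, ?_⟩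
  rw [hc]
  abel

theorem trdStep_tlt {fs : List (VPoly α κ β)} {s s' : VPoly α κ β × VPoly α κ β}
    (h : T.trdStep fs s = Sum.inr s') {v : α × κ} (hv : v ∈ s'.1.support) :
    T.tlt v (T.lt s.1) := by
  obtain ⟨-, ⟨f, -, h0, t, ht, rfl⟩ | ⟨-, rfl⟩⟩ := trdStep_eq_inr h
  · exact tlt_of_mem_support_reduce h0 ht hv
  · exact tlt_of_mem_support_tail hv

theorem trdStep_support {fs : List (VPoly α κ β)} {P : α × κ → Prop}
    (hP : T.LeadClosed (listSet fs) P) {s s' : VPoly α κ β × VPoly α κ β}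
    (h : T.trdStep fs s = Sum.inr s') (hs : ∀ v ∈ s.1.support, P v) :
    ∀ v ∈ s'.1.support, P v := by
  classical
  obtain ⟨hp, ⟨f, hf, h0, t, ht, rfl⟩ | ⟨-, rfl⟩⟩ := trdStep_eq_inr h
  · have := red_lead hf h0 hp ht (r := 0) rfl
    rw [add_zero, add_zero] at this
    exact RedStar.support hP (Relation.ReflTransGen.single this) hs
  · intro v hv
    rw [tail, Finsupp.support_erase] at hv
    exact hs v (Finset.mem_of_mem_erase hv)

theorem dom_trdAux (T : TermOrder α κ) (fs : List (VPoly α κ β)) (p r : VPoly α κ β) :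
    (T.trdAux fs (p, r)).Dom := by
  classical
  obtain ⟨d, hd⟩ := GradedDicksonPowerprod.exists_dicksonGrading (α := α)
  obtain ⟨m, hm⟩ := exists_degree_bound d (p :: fs)
  -- The leading term of `0` is the least term by convention, which need not be a strict decrease;
  -- the flag in the first coordinate makes reaching `0` a descent.
  refine PFun.dom_fix_of_wellFounded (step := T.trdStep fs) (fun _ => rfl)
    (I := fun s => ∀ v ∈ s.1.support, d v.1 ≤ m)
    (InvImage.wf (fun s : VPoly α κ β × VPoly α κ β => (if s.1 = 0 then 0 else 1, T.lt s.1))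
      (WellFounded.prod_lex (wellFounded_lt (α := ℕ)) (wellFounded_boundedLt (T := T) hd m)))
    ?_ (hm p List.mem_cons_self)
  intro s s' hI h
  have hI' := trdStep_support
    (leadClosed_degree hd (F := listSet fs) fun f hf => hm f (List.mem_cons_of_mem _ hf)) h hI
  refine ⟨hI', ?_⟩
  have h0 := (trdStep_eq_inr h).1
  simp only [InvImage, if_neg h0]
  by_cases h0' : s'.1 = 0
  · rw [if_pos h0']
    exact Prod.Lex.left _ _ one_pos
  · rw [if_neg h0']
    have hmem := (lt_spec (T := T) h0').1
    exact Prod.Lex.right _ ⟨hI' _ hmem, trdStep_tlt h hmem⟩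

theorem trd_spec (T : TermOrder α κ) (fs : List (VPoly α κ β)) (p : VPoly α κ β) :
    T.RedStar (listSet fs) p (T.trd fs p) ∧
      ∀ v ∈ (T.trd fs p).support, ∀ f ∈ fs, f ≠ 0 → ¬ TermDvd (T.lt f) v := by
  classical
  have hmem : T.trd fs p ∈ T.trdAux fs (p, 0) := by
    rw [trd, Part.getOrElse_of_dom _ (dom_trdAux T fs p 0)]
    exact Part.get_mem _
  -- All terms already moved to `s.2` lie strictly above those of `s.1`, so reducing the leading
  -- term of `s.1` is a genuine reduction of `s.1 + s.2`.
  have hfin := PFun.exists_final_of_mem_fix (step := T.trdStep fs) (fun _ => rfl)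
    (I := fun s => T.RedStar (listSet fs) p (s.1 + s.2) ∧
      (∀ u ∈ s.2.support, ∀ v ∈ s.1.support, T.tlt v u) ∧
      ∀ v ∈ s.2.support, ∀ f ∈ fs, f ≠ 0 → ¬ TermDvd (T.lt f) v)
    ?_ ⟨by rw [add_zero]; exact Relation.ReflTransGen.refl, by simp, by simp⟩ hmem
  · obtain ⟨s, ⟨hred, -, hirr⟩, hs⟩ := hfin
    obtain rfl := trdStep_eq_inl hs
    exact ⟨by simpa using hred, hirr⟩
  · rintro s s' ⟨hred, hlt, hirr⟩ h
    have hs := fun v => trdStep_tlt (v := v) h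
    obtain ⟨h0, ⟨f, hf, hf0, t, ht, rfl⟩ | ⟨hn, rfl⟩⟩ := trdStep_eq_inr h
    · have hlead := (lt_spec (T := T) h0).1
      refine ⟨hred.tail (red_lead hf hf0 h0 ht ?_),
        fun u hu v hv => (hs v hv).trans_tle (hlt u hu _ hlead).1, hirr⟩
      by_contra hne
      exact (hlt _ (Finsupp.mem_support_iff.2 hne) _ hlead).2 rfl
    · have hlead := (lt_spec (T := T) h0).1
      refine ⟨?_, fun u hu v hv => ?_, fun v hv => ?_⟩
      · have : T.tail s.1 + (s.2 + Finsupp.single (T.lt s.1) (T.lc s.1)) = s.1 + s.2 := by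
          rw [add_comm s.2, ← add_assoc, tail, lc, Finsupp.erase_add_single]
        rwa [this]
      · rcases Finset.mem_union.1 (Finsupp.support_add hu) with hu | hu
        · exact (hs v hv).trans_tle (hlt u hu _ hlead).1
        · rw [Finset.mem_singleton.1 (Finsupp.support_single_subset hu)]
          exact hs v hv
      · rcases Finset.mem_union.1 (Finsupp.support_add hv) with hv | hv
        · exact hirr v hv
        · rw [Finset.mem_singleton.1 (Finsupp.support_single_subset hv)]
          exact hn

end TermOrder

/-! ### S-polynomials and Buchberger's criterion -/

namespace TermOrder

variable {α κ β : Type*} [GradedDicksonPowerprod α] [LinearOrder κ] [WellFoundedLT κ] [Nonempty κ]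
  [Field β] {T : TermOrder α κ}

theorem isGB_of_forall_exists_termDvd {l : List (VPoly α κ β)}
    (h : ∀ p ∈ T.leadSpan (listSet l) fun _ => True, p ≠ 0 →
      ∃ f ∈ l, f ≠ 0 ∧ TermDvd (T.lt f) (T.lt p)) : T.IsGB (listSet l) := by
  classical
  intro p q r hq hr
  obtain ⟨hq', hqi⟩ := trd_spec T l q
  obtain ⟨hr', hri⟩ := trd_spec T l r
  have hmem : T.trd l q - T.trd l r ∈ T.leadSpan (listSet l) fun _ => True := by
    have h₁ := RedStar.sub_mem_leadSpan leadClosed_true (hq.trans hq') fun _ _ => trivial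
    have h₂ := RedStar.sub_mem_leadSpan leadClosed_true (hr.trans hr') fun _ _ => trivial
    have := sub_mem h₂ h₁
    rwa [sub_sub_sub_cancel_left] at this
  have heq : T.trd l q = T.trd l r := by
    by_contra hne
    obtain ⟨f, hf, h0, hdvd⟩ := h _ hmem (sub_ne_zero.2 hne)
    rcases Finset.mem_union.1
      (Finsupp.support_sub (lt_spec (T := T) (sub_ne_zero.2 hne)).1) with hv | hv
    · exact hqi _ hv f hf h0 hdvd
    · exact hri _ hv f hf h0 hdvd
  exact ⟨T.trd l q, hq', heq ▸ hr'⟩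

/-- Elements of the submodule only involve components that appear in `l`, and every term of such a
component is divisible by a leading term `1 · e_i`. -/
theorem isGB_of_genWholeModule {l : List (VPoly α κ β)} (h : T.GenWholeModule l) :
    T.IsGB (listSet l) := by
  refine isGB_of_forall_exists_termDvd fun p hp hp0 => ?_
  have hcomp : T.LeadClosed (listSet l) fun v => ∃ b ∈ l, ∃ w ∈ b.support, w.2 = v.2 :=
    fun f hf _ _ v hv => ⟨f, hf, v, hv, rfl⟩
  have hle : T.leadSpan (listSet l) (fun _ => True) ≤
      T.leadSpan (listSet l) fun v => ∃ b ∈ l, ∃ w ∈ b.support, w.2 = v.2 :=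
    Submodule.span_mono fun _ ⟨f, hf, h0, t, _, hq⟩ =>
      ⟨f, hf, h0, t, ⟨f, hf, _, (lt_spec (T := T) h0).1, rfl⟩, hq⟩
  obtain ⟨b, hb, w, hw, hc⟩ := leadSpan_support hcomp (hle hp) _ (lt_spec (T := T) hp0).1
  obtain ⟨f, hf, h0, hfc, hf1⟩ := h b hb w hw
  refine ⟨f, hf, h0, ?_, hfc.trans hc⟩
  change T.lp f ∣ _
  exact hf1 ▸ one_dvd _

section Spoly

variable {f g : VPoly α κ β}

theorem lp_zero : T.lp (0 : VPoly α κ β) = 1 := by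
  rw [lp, lt, dif_neg (by simp)]
  rfl

theorem spoly_of_ne (h : (T.lt f).2 ≠ (T.lt g).2) : T.spoly f g = 0 := by
  simp [spoly, h]

theorem spoly_of_eq (h : (T.lt f).2 = (T.lt g).2) :
    T.spoly f g =
      monomMult (1 / T.lc f) (ppDiv (GradedDicksonPowerprod.lcm (T.lp f) (T.lp g)) (T.lp f)) f -
      monomMult (1 / T.lc g) (ppDiv (GradedDicksonPowerprod.lcm (T.lp f) (T.lp g)) (T.lp g)) g := by
  simp [spoly, h]

theorem spoly_mem_leadSpan {F : Set (VPoly α κ β)} (hf : f ∈ F) (hg : g ∈ F) :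
    T.spoly f g ∈ T.leadSpan F fun _ => True := by
  by_cases h : (T.lt f).2 = (T.lt g).2
  · rw [spoly_of_eq h]
    exact sub_mem (mem_pmdl_iff.1 (Pmdl.monom _ _ _ (Pmdl.base _ hf)))
      (mem_pmdl_iff.1 (Pmdl.monom _ _ _ (Pmdl.base _ hg)))
  · rw [spoly_of_ne h]
    exact zero_mem _

/-- The least common multiple divides the product of the two leading power-products, so it and the
cofactors respect the bound. -/
theorem degree_of_mem_support_spoly {d : α → ℕ} (hd : IsDicksonGrading d) {m : ℕ}
    (hf : ∀ v ∈ f.support, d v.1 ≤ m) (hg : ∀ v ∈ g.support, d v.1 ≤ m)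
    {v : α × κ} (hv : v ∈ (T.spoly f g).support) : d v.1 ≤ m := by
  classical
  by_cases h : (T.lt f).2 = (T.lt g).2
  swap
  · simp [spoly_of_ne h] at hv
  -- One of `f`, `g` may be zero, with leading power-product `1`. The bound on `d 1` comes from any
  -- term of the other, since `1` divides it.
  have hlp : ∀ p : VPoly α κ β, (∀ v ∈ p.support, d v.1 ≤ m) → d 1 ≤ m → d (T.lp p) ≤ m := by
    intro p hp h1
    by_cases h0 : p = 0
    · rwa [h0, lp_zero]
    · exact hp _ (lt_spec h0).1
  have hlcm : d 1 ≤ m → d (GradedDicksonPowerprod.lcm (T.lp f) (T.lp g)) ≤ m := fun h1 =>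
    (hd.le_of_dvd (GradedDicksonPowerprod.lcm_dvd_mul _ _)).trans
      (hd.mul_le (hlp f hf h1) (hlp g hg h1))
  rw [spoly_of_eq h] at hv
  rcases Finset.mem_union.1 (Finsupp.support_sub hv) with hv | hv <;>
    obtain ⟨w, hw, rfl⟩ := exists_of_monomMult_apply_ne_zero (Finsupp.mem_support_iff.1 hv)
  · exact hd.mul_le ((hd.le_of_dvd (ppDiv_dvd (GradedDicksonPowerprod.dvd_lcm_left _ _))).trans
      (hlcm ((hd.le_of_dvd (one_dvd _)).trans (hf w hw)))) (hf w hw)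
  · exact hd.mul_le ((hd.le_of_dvd (ppDiv_dvd (GradedDicksonPowerprod.dvd_lcm_right _ _))).trans
      (hlcm ((hd.le_of_dvd (one_dvd _)).trans (hg w hw)))) (hg w hw)

theorem tlt_of_mem_support_sub {c e : β} {s t : α} {v : α × κ} (hs : stimes s (T.lt f) = v)
    (ht : stimes t (T.lt g) = v) (hce : c * T.lc f = e * T.lc g) {u : α × κ}
    (hu : u ∈ (monomMult c s f - monomMult e t g).support) : T.tlt u v := by
  classical
  constructor
  · rcases Finset.mem_union.1 (Finsupp.support_sub hu) with hu | hu <;>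
      obtain ⟨w, hw, rfl⟩ := exists_of_monomMult_apply_ne_zero (Finsupp.mem_support_iff.1 hu)
    · exact hs ▸ T.stimes_mono s _ _ (tle_lt hw)
    · exact ht ▸ T.stimes_mono t _ _ (tle_lt hw)
  · rintro rfl
    rw [Finsupp.mem_support_iff, Finsupp.sub_apply] at hu
    nth_rewrite 1 [← hs] at hu
    rw [← ht, monomMult_apply_stimes, monomMult_apply_stimes] at hu
    exact hu (sub_eq_zero.2 hce)

/-- With `v.1 = l * u`, where `l` is the least common multiple, the difference is `u` times the
S-polynomial. The leading terms cancel in the latter, so its reduction to zero uses only leading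
terms below that of `l`; multiplication by `u` moves this bound to `v`. -/
theorem sub_mem_leadSpan_of_spoly {F : Set (VPoly α κ β)} {d : α → ℕ} (hd : IsDicksonGrading d)
    {m : ℕ} (hF : ∀ f ∈ F, ∀ v ∈ f.support, d v.1 ≤ m) (hf : f ∈ F) (hg : g ∈ F) (hf0 : f ≠ 0)
    (hg0 : g ≠ 0) (hS : T.RedStar F (T.spoly f g) 0) {s t : α} {v : α × κ}
    (hs : stimes s (T.lt f) = v) (ht : stimes t (T.lt g) = v) (hv : d v.1 ≤ m) :
    monomMult (1 / T.lc f) s f - monomMult (1 / T.lc g) t g ∈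
      T.leadSpan F fun w => d w.1 ≤ m ∧ T.tlt w v := by
  have hs2 : (T.lt f).2 = v.2 := by rw [← hs, stimes]
  have hc : (T.lt f).2 = (T.lt g).2 := by rw [hs2, ← ht, stimes]
  have hs1 : s * T.lp f = v.1 := congrArg Prod.fst hs
  have ht1 : t * T.lp g = v.1 := congrArg Prod.fst ht
  obtain ⟨u, hu⟩ := GradedDicksonPowerprod.lcm_dvd (T.lp f) (T.lp g) v.1
    ⟨s, by rw [← hs1, mul_comm]⟩ ⟨t, by rw [← ht1, mul_comm]⟩
  have hf1 := ppDiv_mul (GradedDicksonPowerprod.dvd_lcm_left (T.lp f) (T.lp g))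
  have hg1 := ppDiv_mul (GradedDicksonPowerprod.dvd_lcm_right (T.lp f) (T.lp g))
  have hse := spoly_of_eq (T := T) hc
  set l := GradedDicksonPowerprod.lcm (T.lp f) (T.lp g)
  have hsu : s = u * ppDiv l (T.lp f) := by
    apply mul_right_cancel (b := T.lp f)
    rw [hs1, mul_assoc, hf1, hu, mul_comm]
  have htu : t = u * ppDiv l (T.lp g) := by
    apply mul_right_cancel (b := T.lp g)
    rw [ht1, mul_assoc, hg1, hu, mul_comm]
  have heq : monomMult (1 / T.lc f) s f - monomMult (1 / T.lc g) t g =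
      monomMult 1 u (T.spoly f g) := by
    rw [hse, monomMult_sub, monomMult_monomMult, monomMult_monomMult, one_mul, one_mul,
      ← hsu, ← htu]
  have hstep : ∀ w ∈ (T.spoly f g).support, d w.1 ≤ m ∧ T.tlt w (l, (T.lt f).2) := by
    intro w hw
    refine ⟨degree_of_mem_support_spoly hd (hF f hf) (hF g hg) hw, ?_⟩
    rw [hse] at hw
    have hf2 : stimes (ppDiv l (T.lp f)) (T.lt f) = (l, (T.lt f).2) := Prod.ext hf1 rfl
    have hg2 : stimes (ppDiv l (T.lp g)) (T.lt g) = (l, (T.lt f).2) := Prod.ext hg1 hc.symm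
    exact tlt_of_mem_support_sub hf2 hg2
      (by rw [one_div_mul_cancel (lc_ne_zero hf0), one_div_mul_cancel (lc_ne_zero hg0)]) hw
  have hmem := hS.sub_mem_leadSpan ((leadClosed_degree hd hF).and (leadClosed_tlt _)) hstep
  rw [sub_zero] at hmem
  rw [heq]
  refine monomMult_mem_leadSpan_of_mem (fun w hw => ⟨?_, ?_⟩) 1 hmem
  · exact hd.mul_le ((hd.le_of_dvd (hu ▸ dvd_mul_left _ _)).trans hv) hw.1
  · have := stimes_tlt hw.2 u
    rwa [show stimes u (l, (T.lt f).2) = v from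
      Prod.ext (by rw [hu, stimes, mul_comm]) hs2] at this

end Spoly

section Criterion

variable {F : Set (VPoly α κ β)} {d : α → ℕ}

/-- A combination is finite, so the greatest of its leading terms replaces the strict bound `v`.
This provides the descent for the well-founded induction. -/
theorem leadSpan_tlt_exists_tle {m : ℕ} {v : α × κ} {p : VPoly α κ β}
    (hp : p ∈ T.leadSpan F fun w => d w.1 ≤ m ∧ T.tlt w v) :
    p = 0 ∨ ∃ v', T.boundedLt d m v' v ∧
      p ∈ T.leadSpan F fun w => d w.1 ≤ m ∧ T.tle w v' := by
  induction hp using Submodule.span_induction with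
  | mem q hq =>
    obtain ⟨f, hf, h0, t, ht, rfl⟩ := hq
    exact Or.inr ⟨_, ht, monomMult_mem_leadSpan hf h0 (t := t) ⟨ht.1, T.tle_refl _⟩ 1⟩
  | zero => exact Or.inl rfl
  | add p q _ _ hp hq =>
    rcases hp with rfl | ⟨v₁, hv₁, hp⟩
    · rwa [zero_add]
    rcases hq with rfl | ⟨v₂, hv₂, hq⟩
    · rw [add_zero]
      exact Or.inr ⟨v₁, hv₁, hp⟩
    rcases T.tle_total v₁ v₂ with h | h
    · exact Or.inr ⟨v₂, hv₂,
        add_mem (leadSpan_mono (fun w hw => ⟨hw.1, T.tle_trans _ _ _ hw.2 h⟩) hp) hq⟩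
    · exact Or.inr ⟨v₁, hv₁,
        add_mem hp (leadSpan_mono (fun w hw => ⟨hw.1, T.tle_trans _ _ _ hw.2 h⟩) hq)⟩
  | smul e p _ hp =>
    rcases hp with rfl | ⟨v₁, hv₁, hp⟩
    · exact Or.inl (smul_zero e)
    · exact Or.inr ⟨v₁, hv₁, Submodule.smul_mem _ _ hp⟩

theorem exists_bounds_of_mem_leadSpan (m₀ : ℕ) {p : VPoly α κ β}
    (hp : p ∈ T.leadSpan F fun _ => True) :
    ∃ m ≥ m₀, ∃ v, p ∈ T.leadSpan F fun w => d w.1 ≤ m ∧ T.tle w v := by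
  induction hp using Submodule.span_induction with
  | mem q hq =>
    obtain ⟨f, hf, h0, t, -, rfl⟩ := hq
    exact ⟨_, le_max_left _ _, _, monomMult_mem_leadSpan hf h0 (t := t)
      ⟨le_max_right m₀ _, T.tle_refl _⟩ 1⟩
  | zero => exact ⟨m₀, le_rfl, minTerm α κ, zero_mem _⟩
  | add p q _ _ hp hq =>
    obtain ⟨m₁, hm₁, v₁, hp⟩ := hp
    obtain ⟨m₂, hm₂, v₂, hq⟩ := hq
    obtain ⟨v, hv₁, hv₂⟩ : ∃ v, T.tle v₁ v ∧ T.tle v₂ v := by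
      rcases T.tle_total v₁ v₂ with h | h
      exacts [⟨v₂, h, T.tle_refl _⟩, ⟨v₁, T.tle_refl _, h⟩]
    exact ⟨max m₁ m₂, hm₁.trans (le_max_left _ _), v, add_mem
      (leadSpan_mono (fun w hw => ⟨hw.1.trans (le_max_left _ _), T.tle_trans _ _ _ hw.2 hv₁⟩) hp)
      (leadSpan_mono (fun w hw => ⟨hw.1.trans (le_max_right _ _), T.tle_trans _ _ _ hw.2 hv₂⟩) hq)⟩
  | smul e p _ hp =>
    obtain ⟨m, hm, v, hp⟩ := hp
    exact ⟨m, hm, v, Submodule.smul_mem _ _ hp⟩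

/-- Modulo multiples with smaller leading terms, there is at most one multiple of elements of `F`
with leading term `v`, up to scalars. -/
theorem exists_smul_sub_mem_leadSpan (hd : IsDicksonGrading d) {m : ℕ}
    (hF : ∀ f ∈ F, ∀ v ∈ f.support, d v.1 ≤ m)
    (hS : ∀ f ∈ F, ∀ g ∈ F, f ≠ 0 → g ≠ 0 → f ≠ g →
      T.RedStar F (T.spoly f g) 0 ∨ T.RedStar F (T.spoly g f) 0)
    {v : α × κ} (hv : d v.1 ≤ m) {g : VPoly α κ β} (hg : g ∈ F) (hg0 : g ≠ 0) {s : α}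
    (hs : stimes s (T.lt g) = v) {p : VPoly α κ β}
    (hp : p ∈ T.leadSpan F fun w => d w.1 ≤ m ∧ T.tle w v) :
    ∃ c : β, p - c • monomMult (1 / T.lc g) s g ∈
      T.leadSpan F fun w => d w.1 ≤ m ∧ T.tlt w v := by
  induction hp using Submodule.span_induction with
  | mem q hq =>
    obtain ⟨f, hf, hf0, t, ht, rfl⟩ := hq
    by_cases htv : stimes t (T.lt f) = v
    -- The multiple `t · f` is `lc f` times its normalised form, and normalised multiples with the
    -- same leading term agree modulo smaller ones.
    · refine ⟨T.lc f, ?_⟩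
      have hkey : monomMult (1 / T.lc f) t f - monomMult (1 / T.lc g) s g ∈
          T.leadSpan F fun w => d w.1 ≤ m ∧ T.tlt w v := by
        by_cases hfg : f = g
        · subst hfg
          have : t = s := mul_right_cancel (congrArg Prod.fst (htv.trans hs.symm))
          rw [this, sub_self]
          exact zero_mem _
        · rcases hS f hf g hg hf0 hg0 hfg with h | h
          · exact sub_mem_leadSpan_of_spoly hd hF hf hg hf0 hg0 h htv hs hv
          · rw [← neg_sub]
            exact neg_mem (sub_mem_leadSpan_of_spoly hd hF hg hf hg0 hf0 h hs htv hv)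
      have := Submodule.smul_mem _ (T.lc f) hkey
      rwa [smul_sub, smul_monomMult (1 / T.lc f), mul_one_div_cancel (lc_ne_zero hf0)] at this
    · refine ⟨0, ?_⟩
      rw [zero_smul, sub_zero]
      exact monomMult_mem_leadSpan (t := t) hf hf0 ⟨ht.1, ht.2, htv⟩ 1
  | zero => exact ⟨0, by simp⟩
  | add p q _ _ hp hq =>
    obtain ⟨c, hc⟩ := hp
    obtain ⟨e, he⟩ := hq
    refine ⟨c + e, ?_⟩
    rw [add_smul, add_sub_add_comm]
    exact add_mem hc he
  | smul e p _ hp =>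
    obtain ⟨c, hc⟩ := hp
    refine ⟨e * c, ?_⟩
    rw [mul_smul, ← smul_sub]
    exact Submodule.smul_mem _ _ hc

theorem exists_termDvd_of_mem_leadSpan (hd : IsDicksonGrading d) {m : ℕ}
    (hF : ∀ f ∈ F, ∀ v ∈ f.support, d v.1 ≤ m)
    (hS : ∀ f ∈ F, ∀ g ∈ F, f ≠ 0 → g ≠ 0 → f ≠ g →
      T.RedStar F (T.spoly f g) 0 ∨ T.RedStar F (T.spoly g f) 0)
    (v : α × κ) {p : VPoly α κ β} (hp : p ∈ T.leadSpan F fun w => d w.1 ≤ m ∧ T.tle w v)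
    (hp0 : p ≠ 0) : ∃ f ∈ F, f ≠ 0 ∧ TermDvd (T.lt f) (T.lt p) := by
  induction v using (wellFounded_boundedLt (T := T) hd m).induction with
  | _ v ih =>
    have hlt : p ∈ (T.leadSpan F fun w => d w.1 ≤ m ∧ T.tlt w v) →
        ∃ f ∈ F, f ≠ 0 ∧ TermDvd (T.lt f) (T.lt p) := by
      intro hp'
      obtain h | ⟨v', hv', h⟩ := leadSpan_tlt_exists_tle hp'
      exacts [absurd h hp0, ih v' hv' h]
    by_cases hex : d v.1 ≤ m ∧ ∃ g ∈ F, g ≠ 0 ∧ ∃ s, stimes s (T.lt g) = v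
    · obtain ⟨hv, g, hg, hg0, s, hs⟩ := hex
      obtain ⟨c, hc⟩ := exists_smul_sub_mem_leadSpan hd hF hS hv hg hg0 hs hp
      by_cases hc0 : c = 0
      · rw [hc0, zero_smul, sub_zero] at hc
        exact hlt hc
      -- The remainder has only terms strictly below `v`, so the coefficient of `v` in `p` is `c`.
      · have hpv : p v ≠ 0 := by
          have h0 : (p - c • monomMult (1 / T.lc g) s g) v = 0 := by
            by_contra hne
            exact (leadSpan_support ((leadClosed_degree hd hF).and (leadClosed_tlt v)) hc v
              (Finsupp.mem_support_iff.2 hne)).2.2 rfl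
          rw [Finsupp.sub_apply, Finsupp.smul_apply, ← hs, monomMult_apply_stimes, hs,
            show g (T.lt g) = T.lc g from rfl, one_div_mul_cancel (lc_ne_zero hg0), smul_eq_mul,
            mul_one, sub_eq_zero] at h0
          rwa [h0]
        have hlead : T.lt p = v := lt_eq (Finsupp.mem_support_iff.2 hpv) fun u hu =>
          (leadSpan_support ((leadClosed_degree hd hF).and (leadClosed_tle v)) hp u hu).2
        exact ⟨g, hg, hg0, termDvd_iff.2 ⟨s, hs.trans hlead.symm⟩⟩
    -- No multiple within the degree bound has leading term `v`, so all the bounds by `v` are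
    -- strict.
    · refine hlt (Submodule.span_mono ?_ hp)
      rintro _ ⟨f, hf, h0, t, ht, rfl⟩
      refine ⟨f, hf, h0, t, ⟨ht.1, ht.2, fun h => hex ?_⟩, rfl⟩
      exact ⟨h ▸ ht.1, f, hf, h0, t, h⟩

/-- Buchberger's criterion. -/
theorem isGB_of_spoly_redStar {l : List (VPoly α κ β)}
    (hS : ∀ f ∈ l, ∀ g ∈ l, f ≠ 0 → g ≠ 0 → f ≠ g →
      T.RedStar (listSet l) (T.spoly f g) 0 ∨ T.RedStar (listSet l) (T.spoly g f) 0) :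
    T.IsGB (listSet l) := by
  refine isGB_of_forall_exists_termDvd fun p hp hp0 => ?_
  obtain ⟨d, hd⟩ := GradedDicksonPowerprod.exists_dicksonGrading (α := α)
  obtain ⟨m₀, hm₀⟩ := exists_degree_bound d l
  obtain ⟨m, hm, v, hp'⟩ := exists_bounds_of_mem_leadSpan (d := d) m₀ hp
  exact exists_termDvd_of_mem_leadSpan hd (fun f hf v hv => (hm₀ f hf v hv).trans hm) hS v hp' hp0

end Criterion

end TermOrder

/-! ### Bookkeeping of critical pairs, generated submodules and components -/

section Pairs

variable {γ : Type*}

theorem mem_of_mem_listPairs {l : List γ} {x : γ × γ} (h : x ∈ listPairs l) :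
    x.1 ∈ l ∧ x.2 ∈ l := by
  induction l with
  | nil => simp [listPairs] at h
  | cons a l ih =>
    rcases List.mem_append.1 h with h | h
    · obtain ⟨y, hy, rfl⟩ := List.mem_map.1 h
      exact ⟨List.mem_cons_self, List.mem_cons_of_mem _ hy⟩
    · exact (ih h).imp (List.mem_cons_of_mem _) (List.mem_cons_of_mem _)

theorem mem_listPairs_of_ne {l : List γ} {x y : γ} (hx : x ∈ l) (hy : y ∈ l) (hne : x ≠ y) :
    (x, y) ∈ listPairs l ∨ (y, x) ∈ listPairs l := by
  induction l with
  | nil => simp at hx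
  | cons a l ih =>
    simp only [listPairs, List.mem_append, List.mem_map, Prod.mk.injEq]
    rcases List.mem_cons.1 hx with rfl | hx' <;> rcases List.mem_cons.1 hy with rfl | hy'
    · exact absurd rfl hne
    · exact Or.inl (Or.inl ⟨y, hy', rfl, rfl⟩)
    · exact Or.inr (Or.inl ⟨x, hx', rfl, rfl⟩)
    · exact (ih hx' hy').imp Or.inr Or.inr

theorem addPairs_nil (bs : List γ) (ps : List (γ × γ)) : addPairs bs ps [] = ps := by
  simp [addPairs, List.product, listPairs]

theorem mem_addPairs_of_mem_left {bs hs : List γ} {ps : List (γ × γ)} {x : γ × γ} (h : x ∈ ps) :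
    x ∈ addPairs bs ps hs :=
  List.mem_append_left _ h

theorem mk_mem_addPairs {bs hs : List γ} {ps : List (γ × γ)} {x y : γ} (hx : x ∈ hs)
    (hy : y ∈ bs) : (x, y) ∈ addPairs bs ps hs :=
  List.mem_append_right _ (List.mem_append_left _ (List.pair_mem_product.2 ⟨hx, hy⟩))

theorem mem_addPairs_of_ne (bs : List γ) {hs : List γ} (ps : List (γ × γ)) {x y : γ}
    (hx : x ∈ hs) (hy : y ∈ hs) (hne : x ≠ y) :
    (x, y) ∈ addPairs bs ps hs ∨ (y, x) ∈ addPairs bs ps hs := by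
  classical
  exact (mem_listPairs_of_ne (List.mem_dedup.2 hx) (List.mem_dedup.2 hy) hne).imp
    (fun h => List.mem_append_right _ (List.mem_append_right _ h))
    (fun h => List.mem_append_right _ (List.mem_append_right _ h))

theorem mem_diffList {xs ys : List γ} {x : γ} : x ∈ diffList xs ys ↔ x ∈ xs ∧ x ∉ ys := by
  simp [diffList]

theorem length_diffList_lt {xs ys : List γ} (h : ys ≠ []) (hsub : ys ⊆ xs) :
    (diffList xs ys).length < xs.length := by
  obtain ⟨y, hy⟩ := List.exists_mem_of_ne_nil ys h
  exact List.length_filter_lt_length_iff_exists.2 ⟨y, hsub hy, by simpa using hy⟩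

theorem pairsFrom_addPairs {bs hs : List γ} {ps : List (γ × γ)} (h : PairsFrom bs ps) :
    PairsFrom (bs ++ hs) (addPairs bs ps hs) := by
  classical
  intro x hx
  rw [List.mem_append, List.mem_append]
  rcases List.mem_append.1 hx with hx | hx
  · exact (h x hx).imp Or.inl Or.inl
  rcases List.mem_append.1 hx with hx | hx
  · exact (List.pair_mem_product.1 hx).imp Or.inr Or.inl
  · exact (mem_of_mem_listPairs hx).imp (fun h => Or.inr (List.mem_dedup.1 h))
      fun h => Or.inr (List.mem_dedup.1 h)

theorem PairsFrom.diffList {bs : List γ} {ps sps : List (γ × γ)} (h : PairsFrom bs ps) :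
    PairsFrom bs (diffList ps sps) :=
  fun x hx => h x (mem_diffList.1 hx).1

theorem listSet_append (l l' : List γ) : listSet (l ++ l') = listSet l ∪ listSet l' :=
  Set.ext fun _ => List.mem_append

end Pairs

theorem pmdl_subset {α κ β : Type*} [CommMonoid α] [Field β] {A B : Set (VPoly α κ β)}
    (h : A ⊆ pmdl B) : pmdl A ⊆ pmdl B := by
  intro p hp
  induction hp with
  | zero => exact Pmdl.zero
  | base b hb => exact h hb
  | add p q _ _ hp hq => exact Pmdl.add _ _ hp hq
  | monom c t p _ hp => exact Pmdl.monom c t p hp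

theorem pmdl_union_eq {α κ β : Type*} [CommMonoid α] [Field β] {A B : Set (VPoly α κ β)}
    (h : B ⊆ pmdl A) : pmdl (A ∪ B) = pmdl A :=
  (pmdl_subset (Set.union_subset (fun b hb => Pmdl.base b hb) h)).antisymm
    (pmdl_subset fun b hb => Pmdl.base b (Or.inl hb))

theorem exists_component_bound {α κ β : Type*} [Zero β] (l : List (VPoly α κ β)) :
    ∃ C : Finset κ, ∀ f ∈ l, ∀ v ∈ f.support, v.2 ∈ C := by
  classical
  refine ⟨l.toFinset.biUnion fun f => f.support.image Prod.snd, fun f hf v hv => ?_⟩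
  exact Finset.mem_biUnion.2 ⟨f, List.mem_toFinset.2 hf, Finset.mem_image_of_mem _ hv⟩

/-! ### Termination and correctness of the schema, and Buchberger's algorithm -/

section Schema

variable {α κ β : Type*} [GradedDicksonPowerprod α] [LinearOrder κ] [WellFoundedLT κ] [Nonempty κ]
  [Field β] {T : TermOrder α κ}

/-- `bs'` extends `bs` and has an element, of degree at most `m` and with component in `C`, whose
leading term is not divisible by the leading terms of the non-zero elements of `bs`. -/
def NewLead (T : TermOrder α κ) (d : α → ℕ) (m : ℕ) (C : Finset κ)
    (bs' bs : List (VPoly α κ β)) : Prop :=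
  bs ⊆ bs' ∧ ∃ h ∈ bs', h ≠ 0 ∧ d (T.lt h).1 ≤ m ∧ (T.lt h).2 ∈ C ∧
    ∀ b ∈ bs, b ≠ 0 → ¬ TermDvd (T.lt b) (T.lt h)

/-- Along an infinite chain the new elements have leading terms of bounded degree in finitely many
components, so one divides a later one. But the earlier element already belongs to the basis when
the later one is added. -/
theorem wellFounded_newLead {d : α → ℕ} (hd : IsDicksonGrading d) (m : ℕ) (C : Finset κ) :
    WellFounded (NewLead (β := β) T d m C) := by
  rw [wellFounded_iff_isEmpty_descending_chain]
  refine ⟨fun ⟨f, hf⟩ => ?_⟩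
  have hsub : ∀ i j, i ≤ j → f i ⊆ f j := by
    intro i j hij
    induction hij with
    | refl => exact List.Subset.refl _
    | step _ ih => exact List.Subset.trans ih (hf _).1
  choose h hmem h0 hm hC hndvd using fun n => (hf n).2
  obtain ⟨i, j, hij, hdvd, hc⟩ := hd.exists_dvd_and_rel
    (Finite.wellQuasiOrdered fun x y : C => x = y)
    (fun n => ((T.lt (h n)).1, ⟨(T.lt (h n)).2, hC n⟩)) hm
  exact hndvd j (h i) (hsub _ _ hij (hmem i)) (h0 i) ⟨hdvd, congrArg Subtype.val hc⟩

theorem TermOrder.component_mem_of_mem_pmdl (T : TermOrder α κ) {F : Set (VPoly α κ β)}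
    {C : Set κ} (hF : ∀ f ∈ F, ∀ v ∈ f.support, v.2 ∈ C) {p : VPoly α κ β} (hp : p ∈ pmdl F) :
    ∀ v ∈ p.support, v.2 ∈ C := by
  have hle : T.leadSpan F (fun _ => True) ≤ T.leadSpan F fun v => v.2 ∈ C :=
    Submodule.span_mono fun _ ⟨f, hf, h0, t, _, hq⟩ =>
      ⟨f, hf, h0, t, hF f hf (T.lt f) (lt_spec (T := T) h0).1, hq⟩
  exact leadSpan_support (T := T) (F := F) (P := fun v => v.2 ∈ C)
    (fun f hf _ _ v hv => hF f hf v hv) (hle (mem_pmdl_iff.1 hp))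

open Classical in
/-- One step of the completion schema: the result, or the next state. -/
noncomputable def schemaStep (T : TermOrder α κ) (sel : SelFun α κ β) (compl : ComplFun α κ β)
    (s : List (VPoly α κ β) × List (VPoly α κ β × VPoly α κ β)) :
    List (VPoly α κ β) ⊕ List (VPoly α κ β) × List (VPoly α κ β × VPoly α κ β) :=
  if s.2 = [] ∨ T.GenWholeModule s.1 then Sum.inl s.1
  else
    let sps := sel s.1 s.2
    let hs := compl s.1 s.2 sps
    Sum.inr (s.1 ++ hs, addPairs s.1 (diffList s.2 sps) hs)

variable {sel : SelFun α κ β} {compl : ComplFun α κ β}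

theorem schemaStep_eq_inl {s : List (VPoly α κ β) × List (VPoly α κ β × VPoly α κ β)}
    {G : List (VPoly α κ β)} (h : schemaStep T sel compl s = Sum.inl G) :
    s.1 = G ∧ (s.2 = [] ∨ T.GenWholeModule s.1) := by
  unfold schemaStep at h
  split_ifs at h with h0
  exact ⟨Sum.inl_injective h, h0⟩

theorem schemaStep_eq_inr {s s' : List (VPoly α κ β) × List (VPoly α κ β × VPoly α κ β)}
    (h : schemaStep T sel compl s = Sum.inr s') :
    s.2 ≠ [] ∧ s' = (s.1 ++ compl s.1 s.2 (sel s.1 s.2),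
      addPairs s.1 (diffList s.2 (sel s.1 s.2)) (compl s.1 s.2 (sel s.1 s.2))) := by
  unfold schemaStep at h
  split_ifs at h with h0
  exact ⟨fun h' => h0 (Or.inl h'), (Sum.inr_injective h).symm⟩

theorem SchemaRequirements.dom_gbSchemaAux (hreq : SchemaRequirements T sel compl)
    (hbd : GradingBounded sel compl) {bs : List (VPoly α κ β)}
    {ps : List (VPoly α κ β × VPoly α κ β)} (hps : PairsFrom bs ps) :
    (gbSchemaAux T sel compl (bs, ps)).Dom := by
  obtain ⟨d, hd, hdeg⟩ := hbd
  obtain ⟨m, hm⟩ := exists_degree_bound d bs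
  obtain ⟨C, hC⟩ := exists_component_bound bs
  -- If completion returns nothing, the basis is unchanged and the list of pairs shrinks; otherwise
  -- the basis gains a new leading term and the list may grow.
  refine PFun.dom_fix_of_wellFounded (step := schemaStep T sel compl) (fun _ => rfl)
    (I := fun s => PairsFrom s.1 s.2 ∧ (∀ b ∈ s.1, ∀ v ∈ b.support, d v.1 ≤ m) ∧
      ∀ b ∈ s.1, ∀ v ∈ b.support, v.2 ∈ C)
    (InvImage.wf
      (fun s : List (VPoly α κ β) × List (VPoly α κ β × VPoly α κ β) => (s.1, s.2.length))
      (WellFounded.prod_lex (wellFounded_newLead (T := T) hd m C) (wellFounded_lt (α := ℕ))))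
    ?_ ⟨hps, hm, hC⟩
  rintro ⟨bs, ps⟩ s' ⟨hps, hm, hC⟩ h
  obtain ⟨hne, rfl⟩ := schemaStep_eq_inr h
  dsimp only at hps hm hC hne ⊢
  have hm' := hdeg bs ps hne hps m hm
  have hC' : ∀ h ∈ compl bs ps (sel bs ps), ∀ v ∈ h.support, v.2 ∈ C := fun h hh =>
    T.component_mem_of_mem_pmdl (C := C) hC (hreq.mem_pmdl bs ps hne hps h hh)
  have hnd := hreq.not_dvd bs ps hne hps
  have h0 := hreq.zero_notMem bs ps hne hps
  refine ⟨⟨pairsFrom_addPairs hps.diffList,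
    fun b hb => (List.mem_append.1 hb).elim (hm b) (hm' b),
    fun b hb => (List.mem_append.1 hb).elim (hC b) (hC' b)⟩, ?_⟩
  clear h
  generalize compl bs ps (sel bs ps) = hs at *
  simp only [InvImage]
  rcases hs with _ | ⟨h, hs⟩
  · rw [List.append_nil, addPairs_nil]
    exact Prod.Lex.right _
      (length_diffList_lt (hreq.sel_ne_nil bs ps hne) (hreq.sel_subset bs ps hne))
  · have hh0 : h ≠ 0 := by
      rintro rfl
      exact h0 List.mem_cons_self
    have hlead := (TermOrder.lt_spec (T := T) hh0).1
    have hmem : h ∈ h :: hs := List.mem_cons_self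
    exact Prod.Lex.left _ _ ⟨List.subset_append_left _ _, h, List.mem_append_right _ hmem, hh0,
      hm' h hmem _ hlead, hC' h hmem _ hlead, fun b hb hb0 => hnd b hb hb0 h hmem⟩

theorem SchemaRequirements.isGB_and_pmdl_eq (hreq : SchemaRequirements T sel compl)
    {F G : List (VPoly α κ β)} (hG : G ∈ gbSchema T sel compl F) :
    T.IsGB (listSet G) ∧ pmdl (listSet G) = pmdl (listSet F) := by
  -- One order of each pair suffices, as the criterion accepts a reduction to zero of either
  -- S-polynomial. Reductions to zero survive enlargement of the basis, and only selected pairs are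
  -- discarded.
  have hfin := PFun.exists_final_of_mem_fix (step := schemaStep T sel compl) (fun _ => rfl)
    (I := fun s => PairsFrom s.1 s.2 ∧ pmdl (listSet s.1) = pmdl (listSet F) ∧
      ∀ f ∈ s.1, ∀ g ∈ s.1, f ≠ g → (f, g) ∈ s.2 ∨ (g, f) ∈ s.2 ∨
        T.RedStar (listSet s.1) (T.spoly f g) 0 ∨ T.RedStar (listSet s.1) (T.spoly g f) 0)
    ?_ ⟨?_, rfl, ?_⟩ hG
  · obtain ⟨⟨bs, ps⟩, ⟨-, hpm, hS⟩, hs⟩ := hfin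
    obtain ⟨rfl, hs | hs⟩ := schemaStep_eq_inl hs
    · obtain rfl : ps = [] := hs
      refine ⟨TermOrder.isGB_of_spoly_redStar fun f hf g hg _ _ hne => ?_, hpm⟩
      simpa using hS f hf g hg hne
    · exact ⟨TermOrder.isGB_of_genWholeModule hs, hpm⟩
  · rintro ⟨bs, ps⟩ s' ⟨hps, hpm, hS⟩ h
    obtain ⟨hne, rfl⟩ := schemaStep_eq_inr h
    dsimp only at hps hpm hS hne ⊢
    have hred := hreq.spoly_red bs ps hne hps
    have hmem := hreq.mem_pmdl bs ps hne hps
    generalize compl bs ps (sel bs ps) = hs at *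
    generalize sel bs ps = sps at *
    refine ⟨pairsFrom_addPairs hps.diffList, ?_, ?_⟩
    · rw [listSet_append, pmdl_union_eq (B := listSet hs) hmem, hpm]
    · intro f hf g hg hfg
      have hold : ∀ x ∈ ps, x ∈ addPairs bs (diffList ps sps) hs ∨
          T.RedStar (listSet (bs ++ hs)) (T.spoly x.1 x.2) 0 := by
        intro x hx
        by_cases hxs : x ∈ sps
        · rw [listSet_append]
          exact Or.inr (hred x hxs)
        · exact Or.inl (mem_addPairs_of_mem_left (mem_diffList.2 ⟨hx, hxs⟩))
      have hmono : listSet bs ⊆ listSet (bs ++ hs) := List.subset_append_left _ _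
      rcases List.mem_append.1 hf with hf | hf <;> rcases List.mem_append.1 hg with hg | hg
      · rcases hS f hf g hg hfg with h | h | h | h
        · exact (hold _ h).elim Or.inl fun h => Or.inr (Or.inr (Or.inl h))
        · exact (hold _ h).elim (fun h => Or.inr (Or.inl h)) fun h => Or.inr (Or.inr (Or.inr h))
        · exact Or.inr (Or.inr (Or.inl (h.mono hmono)))
        · exact Or.inr (Or.inr (Or.inr (h.mono hmono)))
      · exact Or.inr (Or.inl (mk_mem_addPairs hg hf))
      · exact Or.inl (mk_mem_addPairs hf hg)
      · exact (mem_addPairs_of_ne bs (diffList ps sps) hf hg hfg).imp id Or.inl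
  · simpa using pairsFrom_addPairs (bs := []) (hs := F) (ps := []) (by simp [PairsFrom])
  · intro f hf g hg hfg
    exact (mem_addPairs_of_ne [] [] hf hg hfg).imp id Or.inl

theorem dom_gbSchema (hreq : SchemaRequirements T sel compl) (hbd : GradingBounded sel compl)
    (F : List (VPoly α κ β)) : (gbSchema T sel compl F).Dom :=
  hreq.dom_gbSchemaAux hbd
    (by simpa using pairsFrom_addPairs (bs := []) (hs := F) (ps := []) (by simp [PairsFrom]))

theorem mem_gbCompl {bs : List (VPoly α κ β)} {ps : List (VPoly α κ β × VPoly α κ β)}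
    (hps : PairsFrom bs ps) {h : VPoly α κ β} (hh : h ∈ gbCompl T bs ps (gbSel bs ps)) :
    h ≠ 0 ∧ ∃ f ∈ bs, ∃ g ∈ bs, h = T.trd bs (T.spoly f g) := by
  rcases ps with _ | ⟨x, ps⟩
  · simp [gbSel, gbCompl] at hh
  · simp only [gbSel, List.take_succ_cons, List.take_zero, gbCompl] at hh
    split_ifs at hh with h0
    · simp at hh
    · obtain rfl := List.mem_singleton.1 hh
      have := hps x List.mem_cons_self
      exact ⟨h0, x.1, this.1, x.2, this.2, rfl⟩

theorem schemaRequirements_gb (T : TermOrder α κ) :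
    SchemaRequirements T (gbSel : SelFun α κ β) (gbCompl T) where
  sel_ne_nil bs ps h := by simpa [gbSel] using h
  sel_subset bs ps _ := List.take_subset _ _
  zero_notMem bs ps _ hps h := (mem_gbCompl hps h).1 rfl
  mem_pmdl bs ps _ hps h hh := by
    obtain ⟨-, f, hf, g, hg, rfl⟩ := mem_gbCompl hps hh
    have h₁ := TermOrder.spoly_mem_leadSpan (T := T) (F := listSet bs) hf hg
    have h₂ := (T.trd_spec bs (T.spoly f g)).1.sub_mem_leadSpan TermOrder.leadClosed_true
      fun _ _ => trivial
    have := sub_mem h₁ h₂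
    rw [sub_sub_cancel] at this
    exact TermOrder.mem_pmdl_iff.2 this
  spoly_red bs ps _ _ x hx := by
    rcases ps with _ | ⟨y, ps⟩
    · simp [gbSel] at hx
    · obtain rfl : x = y := by simpa [gbSel] using hx
      have hred := (T.trd_spec bs (T.spoly x.1 x.2)).1
      simp only [gbSel, List.take_succ_cons, List.take_zero, gbCompl]
      split_ifs with h0
      · rw [h0] at hred
        exact hred.mono Set.subset_union_left
      -- The non-zero normal form is itself added to the basis, so one further step with `t = 1`
      -- reduces it to zero.
      · refine (hred.mono Set.subset_union_left).tail ?_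
        refine ⟨_, Or.inr (List.mem_singleton.2 rfl), 1, h0, ?_, ?_⟩ <;> rw [stimes_one]
        · exact TermOrder.lc_ne_zero h0
        · rw [← TermOrder.lc, div_self (TermOrder.lc_ne_zero h0), monomMult_one_right, one_smul,
            sub_self]
  not_dvd bs ps _ hps b hb hb0 h hh := by
    obtain ⟨h0, f, -, g, -, rfl⟩ := mem_gbCompl hps hh
    exact (T.trd_spec bs (T.spoly f g)).2 _ (TermOrder.lt_spec h0).1 b hb hb0

/-- Any Dickson grading works: forming S-polynomials and reducing them both preserve the degree
bound of the basis. -/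
theorem gradingBounded_gb (T : TermOrder α κ) :
    GradingBounded (gbSel : SelFun α κ β) (gbCompl T) := by
  obtain ⟨d, hd⟩ := GradedDicksonPowerprod.exists_dicksonGrading (α := α)
  refine ⟨d, hd, fun bs ps _ hps m hm h hh => ?_⟩
  obtain ⟨-, f, hf, g, hg, rfl⟩ := mem_gbCompl hps hh
  exact (T.trd_spec bs (T.spoly f g)).1.support (TermOrder.leadClosed_degree hd hm) fun _ hv =>
    TermOrder.degree_of_mem_support_spoly hd (hm f hf) (hm g hg) hv

end Schema

theorem mainTheorem2 {α κ β : Type*} [GradedDicksonPowerprod α] [LinearOrder κ] [WellFoundedLT κ]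
    [Nonempty κ] [Field β] (T : TermOrder α κ) :
    -- the schema: termination and partial correctness for all admissible parameters
    (∀ (sel : SelFun α κ β) (compl : ComplFun α κ β), SchemaRequirements T sel compl →
      (GradingBounded sel compl →
        (∀ bs ps, PairsFrom bs ps → (gbSchemaAux T sel compl (bs, ps)).Dom) ∧
        (∀ F : List (VPoly α κ β), (gbSchema T sel compl F).Dom)) ∧
      (∀ F G : List (VPoly α κ β), G ∈ gbSchema T sel compl F →
        T.IsGB (listSet G) ∧ pmdl (listSet G) = pmdl (listSet F))) ∧
    -- total reduction terminates, and Buchberger's parameters are admissible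
    (∀ (fs : List (VPoly α κ β)) (p : VPoly α κ β), (T.trdAux fs (p, 0)).Dom) ∧
    SchemaRequirements T (gbSel : SelFun α κ β) (gbCompl T) ∧
    GradingBounded (gbSel : SelFun α κ β) (gbCompl T) ∧
    -- Buchberger's algorithm terminates with a Gröbner basis of the same submodule
    (∀ F : List (VPoly α κ β), ∃ G : List (VPoly α κ β), G ∈ gb T F ∧
      T.IsGB (listSet G) ∧ pmdl (listSet G) = pmdl (listSet F)) := by
  have hreq := schemaRequirements_gb (β := β) T
  have hbd := gradingBounded_gb (β := β) T
  refine ⟨fun sel compl h => ⟨fun hb => ⟨fun bs ps hps => h.dom_gbSchemaAux hb hps,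
    dom_gbSchema h hb⟩, fun F G hG => h.isGB_and_pmdl_eq hG⟩, fun fs p => T.dom_trdAux fs p 0,
    hreq, hbd, fun F => ?_⟩
  obtain ⟨G, hG⟩ := Part.dom_iff_mem.1 (dom_gbSchema hreq hbd F)
  exact ⟨G, hG, hreq.isGB_and_pmdl_eq hG⟩
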